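/- **Conventions.** A $k$-quasi-median of vertices $x_1,x_2,x_3$ of a connected graph $X$ is a triple of vertices $(y_1,y_2,y_3)$, pairwise at distance $k$, such that for all $i\ne j$ some geodesic from $x_i$ to $x_j$ passes through $y_i$ and then $y_j$, with $k$ as small as possible. A *quasi-median graph* is a connected simplicial graph $X$ in which every triple of vertices has a unique quasi-median, which does not contain $K_4$ minus an edge as an induced subgraph, and in which the convex hull of every isometrically embedded 6-cycle is a 3-cube. A *hyperplane* of $X$ is a class of edges under the equivalence relation generated by identifying two sides of a triangle and opposite sides of an induced square; its *carrier* is the subgraph induced on the endpoints of its edges. Two hyperplanes *cross* if they are dual to two edges forming a corner of an induced square, and *osculate* if their carriers intersect but they do not cross. The *crossing graph* $\Delta X$ (resp. the *contact graph*) has the hyperplanes as vertices, two distinct ones being adjacent when they cross (resp. cross or osculate). A *graph factor system* on a simplicial graph $G$ is a collection $\mathfrak F$ of nonempty induced subgraphs of $G$ (domains) such that $G\in\mathfrak F$; the link of each vertex is in $\mathfrak F$ if it is nonempty; $F_1\cap F_2\in\mathfrak F$ whenever $F_1,F_2\in\mathfrak F$ and $F_1\cap F_2\neq\emptyset$; and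 there is $n>0$ such that every chain $F_1\subsetneq\dots\subsetneq F_k$ in $\mathfrak F$ has $k<n$. If $\Delta X$ admits a graph factor system, let $\mathfrak F$ be the minimal one, consisting of $\Delta X$ and all nonempty intersections of finitely many links of vertices of $\Delta X$. The *factored contact graph* $\widehat{CX}$ is the contact graph of $X$ together with one projection vertex $b_F$ for each $F\in\mathfrak F\setminus\{\Delta X\}$, where $b_F$ is joined by an edge to exactly the hyperplanes that are vertices of $F$. For $J\in\mathfrak F$, the factored contact graph $CJ$ of $J$ is the subgraph of $\widehat{CX}$ induced on the hyperplanes in $J$ and the projection vertices $b_F$ with $F\in\mathfrak F$, $F\subsetneq J$ (so $C(\Delta X)=\widehat{CX}$). **Lemma 4.15.** The factored contact graphs are uniform quasi-trees. That is, there are absolute constants $L\ge 1$ and $A\ge 0$ such that, for every quasi-median graph $X$ whose crossing graph $\Delta X$ admits a graph factor system, the graph $\widehat{CX}$, and more generally $CJ$ for every domain $J\in\mathfrak F$, is connected and $(L,A)$-quasi-isometric to a tree $T$: there is a map $f$ from its vertices to the vertices of $T$ with $L^{-1}d(x,y)-A\le d_T(f(x),f(y))\le L\,d(x,y)+A$ for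 all $x,y$, and every vertex of $T$ is within distance $A$ of the image of $f$. -/

import Mathlib

/-! ### Quasi-median graphs -/

universe u

namespace QMGraph

variable {V : Type u}

/-- `y₁, y₂, y₃` satisfies the first two conditions of a `k`-quasi-median of `x₁, x₂, x₃`:
for `i ≠ j` some geodesic from `xᵢ` to `xⱼ` passes through `yᵢ` and then `yⱼ`, and the `yᵢ` are
pairwise at distance `k` (used only in connected graphs). -/
def IsQuasiMedianCandidate (X : SimpleGraph V) (k : ℕ) (x₁ x₂ x₃ y₁ y₂ y₃ : V) : Prop :=
  (X.dist x₁ x₂ = X.dist x₁ y₁ + X.dist y₁ y₂ + X.dist y₂ x₂ ∧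
    X.dist x₁ x₃ = X.dist x₁ y₁ + X.dist y₁ y₃ + X.dist y₃ x₃ ∧
    X.dist x₂ x₃ = X.dist x₂ y₂ + X.dist y₂ y₃ + X.dist y₃ x₃) ∧
  (X.dist y₁ y₂ = k ∧ X.dist y₁ y₃ = k ∧ X.dist y₂ y₃ = k)

/-- `y₁, y₂, y₃` is a quasi-median of `x₁, x₂, x₃`: a candidate whose size `k` is minimal. -/
def IsQuasiMedianOf (X : SimpleGraph V) (x₁ x₂ x₃ y₁ y₂ y₃ : V) : Prop :=
  ∃ k, IsQuasiMedianCandidate X k x₁ x₂ x₃ y₁ y₂ y₃ ∧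
    ∀ k' z₁ z₂ z₃, IsQuasiMedianCandidate X k' x₁ x₂ x₃ z₁ z₂ z₃ → k ≤ k'

/-- A set of vertices is convex if it contains every vertex of every geodesic between its
elements. -/
def IsConvex (X : SimpleGraph V) (S : Set V) : Prop :=
  ∀ x ∈ S, ∀ y ∈ S, ∀ z, X.dist x z + X.dist z y = X.dist x y → z ∈ S

/-- The convex hull of a set of vertices. -/
def convHull (X : SimpleGraph V) (S : Set V) : Set V :=
  ⋂₀ {T | S ⊆ T ∧ IsConvex X T}

/-- The 1-skeleton of the 3-cube: two vertices are adjacent when they differ in exactly one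
coordinate. -/
def cube3 : SimpleGraph (Fin 3 → Bool) where
  Adj x y := ∃! i, x i ≠ y i
  symm := ⟨fun _ _ ⟨i, hi, hu⟩ => ⟨i, hi.symm, fun j hj => hu j (Ne.symm hj)⟩⟩
  loopless := ⟨fun _ ⟨_, hi, _⟩ => hi rfl⟩

/-- Quasi-median graphs. -/
structure IsQuasiMedianGraph (X : SimpleGraph V) : Prop where
  /-- `X` is connected (geodesics between any two vertices exist). -/
  connected : X.Connected
  /-- Every triple of vertices has a unique quasi-median. -/
  existsUnique_quasiMedian : ∀ x₁ x₂ x₃ : V,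
    ∃! y : V × V × V, IsQuasiMedianOf X x₁ x₂ x₃ y.1 y.2.1 y.2.2
  /-- No induced subgraph is `K₄` minus an edge. -/
  no_K4_minus : ∀ a b c d : V, X.Adj a b → X.Adj a c → X.Adj a d → X.Adj b c → X.Adj b d →
    c ≠ d → X.Adj c d
  /-- The convex hull of every isometrically embedded 6-cycle is a 3-cube. -/
  hexagon_hull : ∀ f : Fin 6 → V,
    (∀ i j, X.dist (f i) (f j) = (SimpleGraph.cycleGraph 6).dist i j) →
    Nonempty (X.induce (convHull X (Set.range f)) ≃g cube3)

/-! ### Hyperplanes -/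

/-- `a, b, c, d` are the consecutive vertices of an induced square. -/
def IsInducedSquare (X : SimpleGraph V) (a b c d : V) : Prop :=
  X.Adj a b ∧ X.Adj b c ∧ X.Adj c d ∧ X.Adj d a ∧ a ≠ c ∧ b ≠ d ∧ ¬ X.Adj a c ∧ ¬ X.Adj b d

/-- Two edges are elementarily parallel if they are two sides of a triangle or two opposite sides
of an induced square. -/
def ElemParallel (X : SimpleGraph V) (e f : X.edgeSet) : Prop :=
  (∃ a b c, X.Adj a b ∧ X.Adj b c ∧ X.Adj a c ∧ (e : Sym2 V) = s(a, b) ∧ (f : Sym2 V) = s(a, c)) ∨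
  (∃ a b c d, IsInducedSquare X a b c d ∧ (e : Sym2 V) = s(a, b) ∧ (f : Sym2 V) = s(d, c))

/-- Parallelism of edges: the equivalence relation generated by `ElemParallel`. -/
def parallelSetoid (X : SimpleGraph V) : Setoid X.edgeSet :=
  Relation.EqvGen.setoid (ElemParallel X)

/-- Hyperplanes: parallelism classes of edges. -/
def Hyperplane (X : SimpleGraph V) : Type u := Quotient (parallelSetoid X)

/-- The hyperplane dual to an edge. -/
def dualHyperplane (X : SimpleGraph V) (e : X.edgeSet) : Hyperplane X :=
  Quotient.mk (parallelSetoid X) e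

/-- The (vertex set of the) carrier of `H`: the endpoints of the edges dual to `H`. -/
def carrier (X : SimpleGraph V) (H : Hyperplane X) : Set V :=
  {v | ∃ e : X.edgeSet, dualHyperplane X e = H ∧ v ∈ (e : Sym2 V)}

/-- `H` and `K` cross if they are dual to two edges that form a corner of an induced square. -/
def Crosses (X : SimpleGraph V) (H K : Hyperplane X) : Prop :=
  ∃ (a b c d : V) (e f : X.edgeSet), IsInducedSquare X a b c d ∧
    (e : Sym2 V) = s(a, b) ∧ (f : Sym2 V) = s(a, d) ∧
    dualHyperplane X e = H ∧ dualHyperplane X f = K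

/-- `H` and `K` osculate if their carriers intersect but they do not cross. -/
def Osculates (X : SimpleGraph V) (H K : Hyperplane X) : Prop :=
  (carrier X H ∩ carrier X K).Nonempty ∧ ¬ Crosses X H K

theorem IsInducedSquare.reflect {X : SimpleGraph V} {a b c d : V} (h : IsInducedSquare X a b c d) :
    IsInducedSquare X a d c b := by
  obtain ⟨h1, h2, h3, h4, h5, h6, h7, h8⟩ := h
  exact ⟨h4.symm, h3.symm, h2.symm, h1.symm, h5, h6.symm, h7, fun h => h8 h.symm⟩

theorem Crosses.symm {X : SimpleGraph V} {H K : Hyperplane X} (h : Crosses X H K) :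
    Crosses X K H := by
  obtain ⟨a, b, c, d, e, f, hs, he, hf, hH, hK⟩ := h
  exact ⟨a, d, c, b, f, e, hs.reflect, hf, he, hK, hH⟩

theorem Osculates.symm {X : SimpleGraph V} {H K : Hyperplane X} (h : Osculates X H K) :
    Osculates X K H :=
  ⟨by rw [Set.inter_comm]; exact h.1, fun hc => h.2 hc.symm⟩

/-- The crossing graph: distinct hyperplanes are adjacent when they cross. -/
def crossingGraph (X : SimpleGraph V) : SimpleGraph (Hyperplane X) where
  Adj H K := H ≠ K ∧ Crosses X H K
  symm := ⟨fun _ _ h => ⟨h.1.symm, h.2.symm⟩⟩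
  loopless := ⟨fun _ h => h.1 rfl⟩

/-- The contact graph: distinct hyperplanes are adjacent when they cross or osculate. -/
def contactGraph (X : SimpleGraph V) : SimpleGraph (Hyperplane X) where
  Adj H K := H ≠ K ∧ (Crosses X H K ∨ Osculates X H K)
  symm := ⟨fun _ _ h => ⟨h.1.symm, h.2.imp Crosses.symm Osculates.symm⟩⟩
  loopless := ⟨fun _ h => h.1 rfl⟩

/-! ### Factor systems and factored contact graphs -/

/-- A graph factor system on a simplicial graph `G`; its members, the domains, are nonempty induced
subgraphs, given by their vertex sets. The link of a vertex `v` is spanned by its neighbours. -/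
structure IsGraphFactorSystem {U : Type u} (G : SimpleGraph U) (𝔉 : Set (Set U)) : Prop where
  nonempty_of_mem : ∀ F ∈ 𝔉, F.Nonempty
  univ_mem : Set.univ ∈ 𝔉
  link_mem : ∀ v, (G.neighborSet v).Nonempty → G.neighborSet v ∈ 𝔉
  inter_mem : ∀ F₁ ∈ 𝔉, ∀ F₂ ∈ 𝔉, (F₁ ∩ F₂).Nonempty → F₁ ∩ F₂ ∈ 𝔉
  /-- Finite complexity: the lengths of strictly increasing chains of domains are bounded. -/
  complexity : ∃ n : ℕ, 0 < n ∧ ∀ (k : ℕ) (F : Fin k → Set U),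
    (∀ i, F i ∈ 𝔉) → StrictMono F → k < n

/-- The domains of the minimal factor system of a graph `G`: `G` itself and the nonempty
intersections of finitely many (at least one) links of vertices. -/
def minimalDomains {U : Type u} (G : SimpleGraph U) : Set (Set U) :=
  {F | F.Nonempty ∧
    (F = Set.univ ∨ ∃ s : Finset U, s.Nonempty ∧ F = ⋂ v ∈ s, G.neighborSet v)}

/-- The domains of a quasi-median graph: those of the minimal factor system of its crossing
graph. -/
def domains (X : SimpleGraph V) : Set (Set (Hyperplane X)) :=
  minimalDomains (crossingGraph X)

/-- The projection vertices `b_F`: one for each domain `F` other than the whole crossing graph. -/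
abbrev ProjVertex (X : SimpleGraph V) : Type u :=
  {F : Set (Hyperplane X) // F ∈ domains X ∧ F ≠ Set.univ}

/-- Adjacency in the factored contact graph: hyperplanes are adjacent as in the contact graph, a
hyperplane `H` is adjacent to a projection vertex `b_F` when `H ∈ F`, and projection vertices are
pairwise non-adjacent. -/
def FactoredAdj (X : SimpleGraph V) :
    Hyperplane X ⊕ ProjVertex X → Hyperplane X ⊕ ProjVertex X → Prop
  | Sum.inl H, Sum.inl K => (contactGraph X).Adj H K
  | Sum.inl H, Sum.inr F => H ∈ F.1
  | Sum.inr F, Sum.inl H => H ∈ F.1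
  | Sum.inr _, Sum.inr _ => False

/-- The factored contact graph of `X`. -/
def factoredContactGraph (X : SimpleGraph V) :
    SimpleGraph (Hyperplane X ⊕ ProjVertex X) where
  Adj := FactoredAdj X
  symm := ⟨by
    rintro (H | F) (K | F') h
    · exact SimpleGraph.Adj.symm h
    · exact h
    · exact h
    · exact h⟩
  loopless := ⟨by
    rintro (H | F) h
    · exact SimpleGraph.irrefl (contactGraph X) h
    · exact h⟩

/-- The vertices of the factored contact graph that belong to a domain `J`: the hyperplanes in `J`
and the projection vertices of the domains properly contained in `J`. -/
def domainVertices (X : SimpleGraph V) (J : Set (Hyperplane X)) :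
    Set (Hyperplane X ⊕ ProjVertex X) :=
  {z | Sum.elim (fun H => H ∈ J) (fun F => F.1 ⊂ J) z}

/-- The factored contact graph of a domain `J`: the subgraph of the factored contact graph of `X`
induced on `domainVertices X J`. -/
def factoredContactGraphOf (X : SimpleGraph V) (J : Set (Hyperplane X)) :
    SimpleGraph (domainVertices X J) :=
  (factoredContactGraph X).induce (domainVertices X J)

/-! ### Quasi-trees -/

/-- The connected graph `G`, with its path metric, is `(L, A)`-quasi-isometric to a tree. -/
def IsQuasiTreeWith {U : Type u} (L A : ℝ) (G : SimpleGraph U) : Prop :=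
  G.Connected ∧ ∃ (T : Type u) (Γ : SimpleGraph T), Γ.IsTree ∧ ∃ f : U → T,
    (∀ x y, L⁻¹ * (G.dist x y : ℝ) - A ≤ (Γ.dist (f x) (f y) : ℝ) ∧
      (Γ.dist (f x) (f y) : ℝ) ≤ L * (G.dist x y : ℝ) + A) ∧
    ∀ t, ∃ x, (Γ.dist t (f x) : ℝ) ≤ A

end QMGraph

/-!
Let `K` and `L` be hyperplanes of a domain `J`. The hyperplanes dual to the edges of a shortest
geodesic between their carriers separate `K` from `L`, and consecutive ones are in contact. Since a
hyperplane that crosses both `K` and `L` crosses every hyperplane separating them, these separators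
belong to `J`, so `K` and `L` are joined in the factored contact graph of `J` by a path of
separators. Conversely, a path from `K` to `L` has to switch sides of each separator `H`, and it can
do so only next to `H`: carriers in contact that do not cross `H` lie on the same side of `H`, and
so do the carriers of the members of a domain that do not cross `H`, unless this domain contains
`H`. Hence factored contact graphs satisfy Manning's bottleneck criterion with an absolute constant.
The criterion bounds the diameters of the clusters of spheres around a base point, and the tree of
these clusters is quasi-isometric to the graph.
-/

namespace QMGraph

open SimpleGraph

/-! ### Trees of clusters and the bottleneck property -/

section QuasiTree

variable {U : Type u} {T : Type*} {G : SimpleGraph U} {Γ : SimpleGraph T}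

theorem dist_le_dist_add_one_of_adj (u : U) {v w : U} (h : G.Adj v w) :
    G.dist u v ≤ G.dist u w + 1 := by
  have := h.symm.diff_dist_adj (u := u)
  omega

theorem exists_adj_dist_add_one (hG : G.Connected) {u v : U} (hne : u ≠ v) :
    ∃ w, G.Adj v w ∧ G.dist u w + 1 = G.dist u v := by
  obtain ⟨P, hP⟩ := hG.exists_walk_length_eq_dist v u
  cases P with
  | nil => exact absurd rfl hne
  | @cons _ w _ hvw Q =>
    have hle := dist_le_dist_add_one_of_adj u hvw
    have hQ := dist_le Q
    rw [Walk.length_cons, dist_comm] at hP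
    rw [dist_comm] at hQ
    exact ⟨w, hvw, by omega⟩

theorem dist_add_dist_of_mem_support (hG : G.Connected) {u v w : U} {P : G.Walk u v}
    (hP : P.length = G.dist u v) (hw : w ∈ P.support) :
    G.dist u w + G.dist w v = G.dist u v := by
  classical
  have htake := dist_le (P.takeUntil w hw)
  have hdrop := dist_le (P.dropUntil w hw)
  have hlength := congrArg Walk.length (P.take_spec hw)
  rw [Walk.length_append] at hlength
  have htri := hG.dist_triangle (u := u) (v := w) (w := v)
  omega

theorem exists_walk_length_le {f : U → T} (hf : ∀ u v, G.Adj u v → f u = f v ∨ Γ.Adj (f u) (f v))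
    {u v : U} (P : G.Walk u v) : ∃ Q : Γ.Walk (f u) (f v), Q.length ≤ P.length := by
  induction P with
  | nil => exact ⟨.nil, le_rfl⟩
  | cons h P ih =>
    obtain ⟨Q, hQ⟩ := ih
    rcases hf _ _ h with heq | hadj
    · exact ⟨Q.copy heq.symm rfl, by simpa using hQ.trans (Nat.le_succ _)⟩
    · exact ⟨.cons hadj Q, by simpa using hQ⟩

theorem dist_map_le (hG : G.Connected) {f : U → T}
    (hf : ∀ u v, G.Adj u v → f u = f v ∨ Γ.Adj (f u) (f v)) (u v : U) :
    Γ.dist (f u) (f v) ≤ G.dist u v := by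
  obtain ⟨P, hP⟩ := hG.exists_walk_length_eq_dist u v
  obtain ⟨Q, hQ⟩ := exists_walk_length_le hf P
  exact (dist_le Q).trans (hQ.trans hP.le)

theorem isAcyclic_of_level (level : T → ℕ)
    (h : ∀ s t t', Γ.Adj s t → Γ.Adj s t' → level t ≤ level s → level t' ≤ level s → t = t') :
    Γ.IsAcyclic := by
  classical
  intro v c hc
  obtain ⟨s, hs, hmax⟩ := c.support.toFinset.exists_max_image level ⟨v, by simp⟩
  rw [List.mem_toFinset] at hs
  have hmax' : ∀ t ∈ (c.rotate s hs).support, level t ≤ level s := fun t ht =>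
    hmax t (List.mem_toFinset.2 ((Walk.mem_support_rotate_iff ..).1 ht))
  have hcycle := hc.rotate hs
  have hnil := hcycle.not_nil
  exact hcycle.snd_ne_penultimate (h s _ _ (Walk.adj_snd hnil) (Walk.adj_penultimate hnil).symm
    (hmax' _ (Walk.getVert_mem_support _ _)) (hmax' _ (Walk.getVert_mem_support _ _)))

/-- Two vertices of a sphere around `o` lie in the same cluster if they are joined by a walk outside
the open ball bounded by that sphere. -/
def SameCluster (G : SimpleGraph U) (o u v : U) : Prop :=
  G.dist o u = G.dist o v ∧ ∃ P : G.Walk u v, ∀ w ∈ P.support, G.dist o u ≤ G.dist o w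

theorem SameCluster.refl (o u : U) : SameCluster G o u u :=
  ⟨rfl, .nil, by simp⟩

theorem SameCluster.symm {o u v : U} (h : SameCluster G o u v) : SameCluster G o v u := by
  obtain ⟨hdist, P, hP⟩ := h
  exact ⟨hdist.symm, P.reverse, fun w hw => hdist ▸ hP w (by simpa using hw)⟩

theorem SameCluster.trans {o u v w : U} (h : SameCluster G o u v) (h' : SameCluster G o v w) :
    SameCluster G o u w := by
  obtain ⟨hdist, P, hP⟩ := h
  obtain ⟨hdist', Q, hQ⟩ := h'
  refine ⟨hdist.trans hdist', P.append Q, fun z hz => ?_⟩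
  exact ((Walk.mem_support_append_iff _ _).1 hz).elim (hP z) fun hz => hdist ▸ hQ z hz

theorem SameCluster.of_adj {o u v : U} (hadj : G.Adj u v) (hdist : G.dist o u = G.dist o v) :
    SameCluster G o u v :=
  ⟨hdist, hadj.toWalk, fun w hw => by
    rcases List.mem_pair.1 hw with rfl | rfl
    exacts [le_rfl, hdist.le]⟩

/-- The partition of the vertices into clusters of spheres around `o`. -/
def clusterSetoid (G : SimpleGraph U) (o : U) : Setoid U where
  r := SameCluster G o
  iseqv := ⟨SameCluster.refl o, SameCluster.symm, SameCluster.trans⟩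

/-- The graph of clusters of spheres around `o`: distinct clusters are adjacent when some edge of
`G` joins them. It is a tree as soon as `G` is connected. -/
def layeringTree (G : SimpleGraph U) (o : U) : SimpleGraph (Quotient (clusterSetoid G o)) :=
  G.map (Quotient.mk (clusterSetoid G o))

theorem layeringTree_eq_or_adj (o u v : U) (h : G.Adj u v) :
    Quotient.mk (clusterSetoid G o) u = Quotient.mk (clusterSetoid G o) v ∨
      (layeringTree G o).Adj (Quotient.mk _ u) (Quotient.mk _ v) :=
  or_iff_not_imp_left.2 fun hne => ⟨hne, u, v, h, rfl, rfl⟩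

theorem exists_adj_of_layeringTree_adj {o : U} {s t : Quotient (clusterSetoid G o)}
    (h : (layeringTree G o).Adj s t) :
    ∃ u v, G.Adj u v ∧ Quotient.mk _ u = s ∧ Quotient.mk _ v = t ∧ G.dist o u ≠ G.dist o v := by
  obtain ⟨hne, u, v, hadj, rfl, rfl⟩ := h
  exact ⟨u, v, hadj, rfl, rfl, fun hdist => hne (Quotient.sound (SameCluster.of_adj hadj hdist))⟩

theorem isAcyclic_layeringTree (G : SimpleGraph U) (o : U) : (layeringTree G o).IsAcyclic := by
  refine isAcyclic_of_level
    (Quotient.lift (G.dist o) fun _ _ (h : SameCluster G o _ _) => h.1) fun s t t' ht ht' => ?_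
  obtain ⟨u, v, huv, rfl, rfl, hne⟩ := exists_adj_of_layeringTree_adj ht
  obtain ⟨u', v', huv', hu', rfl, hne'⟩ := exists_adj_of_layeringTree_adj ht'
  obtain ⟨hdist, P, hP⟩ : SameCluster G o u u' := (Quotient.exact hu').symm
  intro (hv : G.dist o v ≤ G.dist o u) (hv' : G.dist o v' ≤ G.dist o u)
  have hvu := dist_le_dist_add_one_of_adj o huv
  have hvu' := dist_le_dist_add_one_of_adj o huv'
  refine Quotient.sound ⟨by omega, .cons huv.symm (P.concat huv'), fun z hz => ?_⟩
  rw [Walk.support_cons, Walk.support_concat, List.mem_cons, List.mem_append,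
    List.mem_singleton] at hz
  rcases hz with rfl | hz | rfl
  · exact le_rfl
  · exact hv.trans (hP z hz)
  · omega

theorem isTree_layeringTree (hG : G.Connected) (o : U) : (layeringTree G o).IsTree := by
  have : Nonempty (Quotient (clusterSetoid G o)) := ⟨Quotient.mk _ o⟩
  refine ⟨⟨fun s t => ?_⟩, isAcyclic_layeringTree G o⟩
  induction s, t using Quotient.inductionOn₂ with
  | _ u v =>
    obtain ⟨P⟩ := hG u v
    obtain ⟨Q, -⟩ := exists_walk_length_le (layeringTree_eq_or_adj o) P
    exact ⟨Q⟩

theorem dist_le_mul_length_add_of_layeringTree_walk (hG : G.Connected) {o : U} {D : ℕ}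
    (hD : ∀ u v, SameCluster G o u v → G.dist u v ≤ D) {s t : Quotient (clusterSetoid G o)}
    (P : (layeringTree G o).Walk s t) (u v : U) (hu : Quotient.mk _ u = s)
    (hv : Quotient.mk _ v = t) : G.dist u v ≤ (D + 1) * P.length + D := by
  induction P generalizing u with
  | nil => simpa using hD u v (Quotient.exact (hu.trans hv.symm))
  | cons h P ih =>
    obtain ⟨u', w, hadj, hu', hw, -⟩ := exists_adj_of_layeringTree_adj h
    calc G.dist u v ≤ G.dist u u' + (G.dist u' w + G.dist w v) :=
          hG.dist_triangle.trans (Nat.add_le_add_left hG.dist_triangle _)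
      _ ≤ D + (1 + ((D + 1) * P.length + D)) := by
          gcongr
          · exact hD u u' (Quotient.exact (hu.trans hu'.symm))
          · exact (dist_eq_one_iff_adj.2 hadj).le
          · exact ih w hw hv
      _ = (D + 1) * (P.cons h).length + D := by
          rw [Walk.length_cons]
          ring

theorem isQuasiTreeWith_of_cluster_dist_le (hG : G.Connected) {o : U} {D : ℕ}
    (hD : ∀ u v, SameCluster G o u v → G.dist u v ≤ D) : IsQuasiTreeWith (D + 1) D G := by
  have hT := isTree_layeringTree hG o
  refine ⟨hG, _, layeringTree G o, hT, Quotient.mk _, fun u v => ⟨?_, ?_⟩, ?_⟩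
  · obtain ⟨P, hP⟩ := hT.1.exists_walk_length_eq_dist (Quotient.mk _ u) (Quotient.mk _ v)
    have hle := dist_le_mul_length_add_of_layeringTree_walk hG hD P u v rfl rfl
    rw [hP] at hle
    rw [sub_le_iff_le_add, inv_mul_le_iff₀ (by positivity)]
    exact_mod_cast hle.trans (by rw [mul_add]; gcongr; exact Nat.le_mul_of_pos_left D D.succ_pos)
  · have hle := dist_map_le hG (layeringTree_eq_or_adj o) u v
    exact_mod_cast hle.trans
      ((Nat.le_mul_of_pos_left _ D.succ_pos).trans (Nat.le_add_right _ D))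
  · refine Quotient.ind fun v => ⟨v, ?_⟩
    rw [dist_self, Nat.cast_zero]
    positivity

theorem IsQuasiTreeWith.of_iso {U' : Type u} {G' : SimpleGraph U'} {L A : ℝ} (e : G ≃g G')
    (h : IsQuasiTreeWith L A G') : IsQuasiTreeWith L A G := by
  obtain ⟨hG', T, Γ, hΓ, f, hf, hsurj⟩ := h
  have hG : G.Connected := e.connected_iff.2 hG'
  have hdist (x y : U) : G'.dist (e x) (e y) = G.dist x y := by
    refine le_antisymm (dist_map_le hG (fun _ _ h => .inr (e.map_adj_iff.2 h)) x y) ?_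
    simpa using dist_map_le hG' (fun _ _ h => .inr (e.symm.map_adj_iff.2 h)) (e x) (e y)
  refine ⟨hG, T, Γ, hΓ, f ∘ e, fun x y => hdist x y ▸ hf (e x) (e y), fun t => ?_⟩
  obtain ⟨x, hx⟩ := hsurj t
  exact ⟨e.symm x, by simpa using hx⟩

/-- Every vertex of the walk `P` is within distance `δ` of every walk with the same endpoints. -/
def IsTight (δ : ℕ) {x y : U} (P : G.Walk x y) : Prop :=
  ∀ z ∈ P.support, ∀ W : G.Walk x y, ∃ w ∈ W.support, G.dist z w ≤ δ

theorem IsTight.reverse {δ : ℕ} {x y : U} {P : G.Walk x y} (h : IsTight δ P) :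
    IsTight δ P.reverse := by
  intro z hz W
  obtain ⟨w, hw, hzw⟩ := h z (by simpa using hz) W.reverse
  exact ⟨w, by simpa using hw, hzw⟩

theorem IsTight.mono {δ ε : ℕ} {x y : U} {P : G.Walk x y} (h : IsTight δ P) (hle : δ ≤ ε) :
    IsTight ε P := fun z hz W =>
  (h z hz W).imp fun _ hw => ⟨hw.1, hw.2.trans hle⟩

theorem IsTight.cons {δ : ℕ} {x k y : U} {P : G.Walk k y} (h : IsTight δ P) (hadj : G.Adj x k) :
    IsTight (δ + 1) (P.cons hadj) := by
  intro z hz W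
  rcases List.mem_cons.1 hz with rfl | hz
  · exact ⟨z, W.start_mem_support, by simp⟩
  obtain ⟨w, hw, hzw⟩ := h z hz (W.cons hadj.symm)
  rcases List.mem_cons.1 hw with rfl | hw
  · exact ⟨x, W.start_mem_support, (dist_le_dist_add_one_of_adj z hadj).trans (by omega)⟩
  · exact ⟨w, hw, by omega⟩

/-- Manning's bottleneck property with constant `δ`, required of all the vertices of some walk
between two given vertices. -/
def HasBottlenecks (G : SimpleGraph U) (δ : ℕ) : Prop :=
  ∀ x y, ∃ P : G.Walk x y, IsTight δ P

theorem exists_isTight_of_dense {δ : ℕ} {S : Set U} (hS : ∀ x, x ∈ S ∨ ∃ k ∈ S, G.Adj x k) {y : U}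
    (h : ∀ k ∈ S, ∃ P : G.Walk k y, IsTight δ P) (x : U) :
    ∃ P : G.Walk x y, IsTight (δ + 1) P := by
  rcases hS x with hx | ⟨k, hk, hadj⟩
  · obtain ⟨P, hP⟩ := h x hx
    exact ⟨P, hP.mono (Nat.le_succ δ)⟩
  · obtain ⟨P, hP⟩ := h k hk
    exact ⟨P.cons hadj, hP.cons hadj⟩

theorem hasBottlenecks_of_dense {δ : ℕ} {S : Set U} (hS : ∀ x, x ∈ S ∨ ∃ k ∈ S, G.Adj x k)
    (h : ∀ k ∈ S, ∀ l ∈ S, ∃ P : G.Walk k l, IsTight δ P) : HasBottlenecks G (δ + 2) := by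
  refine fun x y => exists_isTight_of_dense hS (fun k hk => ?_) x
  obtain ⟨P, hP⟩ := exists_isTight_of_dense hS (fun l hl => h l hl k hk) y
  exact ⟨P.reverse, hP.reverse⟩

theorem HasBottlenecks.connected [Nonempty U] {δ : ℕ} (h : HasBottlenecks G δ) : G.Connected :=
  ⟨fun x y => ⟨(h x y).choose⟩⟩

theorem dist_le_of_walk_near (hG : G.Connected) {u v : U} {r : ℕ} (P : G.Walk u v)
    (hP : ∀ z ∈ P.support, G.dist u z ≤ r ∨ G.dist v z ≤ r) : G.dist u v ≤ 2 * r + 1 := by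
  by_cases hv : G.dist u v ≤ r
  · omega
  obtain ⟨d, hd, hfst : G.dist u d.fst ≤ r, hsnd⟩ :=
    P.exists_boundary_dart {z | G.dist u z ≤ r} (by simp) hv
  have hsnd' := (hP _ (P.dart_snd_mem_support_of_mem_darts hd)).resolve_left hsnd
  have hle := dist_le_dist_add_one_of_adj u d.adj.symm
  have htri := hG.dist_triangle (u := u) (v := d.snd) (w := v)
  rw [dist_comm (u := d.snd)] at htri
  omega

theorem IsTight.dist_le_of_sameCluster (hG : G.Connected) {δ : ℕ} {o u v : U} {P : G.Walk u v}
    (hP : IsTight δ P) (huv : SameCluster G o u v) : G.dist u v ≤ 6 * δ + 1 := by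
  obtain ⟨hdist, W, hW⟩ := huv
  obtain ⟨A, hA⟩ := hG.exists_walk_length_eq_dist o u
  obtain ⟨B, hB⟩ := hG.exists_walk_length_eq_dist o v
  suffices hnear : ∀ z ∈ P.support, G.dist u z ≤ 3 * δ ∨ G.dist v z ≤ 3 * δ by
    have := dist_le_of_walk_near hG P hnear
    omega
  intro z hz
  -- A point of a geodesic from `o` to `u` or `v` that is nearly as far from `o` as the cluster is
  -- close to the end of that geodesic.
  have hnear {t s : U} (ht : G.dist o t = G.dist o u) (hzs : G.dist z s ≤ δ)
      (hs : G.dist o s + G.dist s t = G.dist o t) : G.dist t z ≤ 3 * δ := by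
    obtain ⟨w, hw, hzw⟩ := hP z hz W
    have hou := hW w hw
    have how := hG.dist_triangle (u := o) (v := z) (w := w)
    have hoz := hG.dist_triangle (u := o) (v := s) (w := z)
    have htz := hG.dist_triangle (u := t) (v := s) (w := z)
    rw [dist_comm (u := s)] at hoz
    rw [dist_comm (u := t) (v := s), dist_comm (u := s) (v := z)] at htz
    omega
  obtain ⟨s, hs, hzs⟩ := hP z hz (A.reverse.append B)
  rcases (Walk.mem_support_append_iff _ _).1 hs with hs | hs
  · rw [Walk.support_reverse, List.mem_reverse] at hs
    exact .inl (hnear rfl hzs (dist_add_dist_of_mem_support hG hA hs))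
  · exact .inr (hnear hdist.symm hzs (dist_add_dist_of_mem_support hG hB hs))

theorem HasBottlenecks.isQuasiTreeWith [Nonempty U] {δ : ℕ} (h : HasBottlenecks G δ) :
    IsQuasiTreeWith (6 * δ + 2) (6 * δ + 1) G := by
  have hdiam (u v : U) (huv : SameCluster G (Classical.arbitrary U) u v) :
      G.dist u v ≤ 6 * δ + 1 :=
    (h u v).choose_spec.dist_le_of_sameCluster h.connected huv
  convert isQuasiTreeWith_of_cluster_dist_le h.connected hdiam using 1
  · push_cast
    ring
  · push_cast
    rfl

end QuasiTree

/-! ### The triangle and quadrangle conditions -/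

/-- The neighbour of the vertex `x` of the cube across its `i`-th coordinate. -/
def cubeFlip (x : Fin 3 → Bool) (i : Fin 3) : Fin 3 → Bool := Function.update x i (!x i)

theorem cube3_adj_iff :
    ∀ x y : Fin 3 → Bool, cube3.Adj x y ↔ ∃ i, y = cubeFlip x i := by
  change ∀ x y : Fin 3 → Bool, (∃ i, x i ≠ y i ∧ ∀ j, x j ≠ y j → j = i) ↔ ∃ i, y = cubeFlip x i
  decide

theorem cubeFlip_comm : ∀ (x : Fin 3 → Bool) (i j : Fin 3),
    cubeFlip (cubeFlip x i) j = cubeFlip (cubeFlip x j) i := by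
  decide

theorem exists_eq_cubeFlip : ∀ (x : Fin 3 → Bool) (i j k l : Fin 3), i ≠ j →
    (∃ m, cubeFlip (cubeFlip (cubeFlip x i) k) l = cubeFlip x m) ∨
      ∃ m, cubeFlip (cubeFlip (cubeFlip x i) k) l = cubeFlip (cubeFlip (cubeFlip x i) j) m := by
  decide

theorem cube3_exists_common {z v w p y : Fin 3 → Bool} (hzv : cube3.Adj z v)
    (hzw : cube3.Adj z w) (hvw : v ≠ w) (hvp : cube3.Adj v p) (hpy : cube3.Adj p y)
    (hzy : ¬ cube3.Adj z y) : ∃ x, cube3.Adj v x ∧ cube3.Adj w x ∧ cube3.Adj x y := by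
  simp only [cube3_adj_iff] at *
  obtain ⟨i, rfl⟩ := hzv
  obtain ⟨j, rfl⟩ := hzw
  obtain ⟨k, rfl⟩ := hvp
  obtain ⟨l, rfl⟩ := hpy
  have hij : i ≠ j := fun h => hvw (h ▸ rfl)
  exact ⟨cubeFlip (cubeFlip z i) j, ⟨j, rfl⟩, ⟨i, cubeFlip_comm z i j⟩,
    (exists_eq_cubeFlip z i j k l hij).resolve_left hzy⟩

theorem dist_cycleGraph_add_le {n : ℕ} (i k : Fin (n + 2)) :
    (cycleGraph (n + 2)).dist i (i + k) ≤ k := by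
  induction k using Fin.induction with
  | zero => simp
  | succ k ih =>
    have hadj : (cycleGraph (n + 2)).Adj (i + k.succ) (i + k.castSucc) := by
      simp [cycleGraph_adj, ← Fin.coeSucc_eq_succ, ← add_assoc]
    exact (dist_le_dist_add_one_of_adj i hadj).trans (Nat.succ_le_succ ih)

theorem dist_cycleGraph_six_add_dist_antipode (i j : Fin 6) :
    (cycleGraph 6).dist i j + (cycleGraph 6).dist j (i + 3) ≤ 3 := by
  obtain ⟨k, l, hkl, hk⟩ : ∃ k l : Fin 6, (k : ℕ) + l = 3 ∧
      (j = i + k ∧ i + 3 = j + l ∨ j = i + 3 + k ∧ i = j + l) := by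
    revert i j
    decide
  rw [← hkl]
  rcases hk with ⟨hj, hi⟩ | ⟨hj, hi⟩
  · rw [hi]
    exact add_le_add (hj ▸ dist_cycleGraph_add_le i k) (dist_cycleGraph_add_le j l)
  · rw [add_comm, SimpleGraph.dist_comm (v := i + 3), SimpleGraph.dist_comm (u := i)]
    exact add_le_add (hj ▸ dist_cycleGraph_add_le (i + 3) k)
      (hi ▸ dist_cycleGraph_add_le j l)

section Distance

variable {V : Type u} {X : SimpleGraph V}

theorem dist_map_cycleGraph_six (hX : X.Connected) {f : Fin 6 → V}
    (hadj : ∀ i, X.Adj (f i) (f (i + 1))) (hdist : ∀ i, X.dist (f i) (f (i + 3)) = 3)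
    (i j : Fin 6) : X.dist (f i) (f j) = (cycleGraph 6).dist i j := by
  have hle (i j : Fin 6) : X.dist (f i) (f j) ≤ (cycleGraph 6).dist i j := by
    refine dist_map_le cycleGraph_connected (fun i j h => .inr ?_) i j
    rcases cycleGraph_adj.1 h with h | h
    · rw [sub_eq_iff_eq_add'.1 h]
      exact (hadj j).symm
    · rw [sub_eq_iff_eq_add'.1 h]
      exact hadj i
  refine (hle i j).antisymm ?_
  have htri := hX.dist_triangle (u := f i) (v := f j) (w := f (i + 3))
  rw [hdist] at htri
  have hanti := hle j (i + 3)
  have hsum := dist_cycleGraph_six_add_dist_antipode i j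
  omega

theorem dist_le_dist_add_one_of_adj_left {v w : V} (h : X.Adj v w) (u : V) :
    X.dist v u ≤ X.dist w u + 1 := by
  simpa only [SimpleGraph.dist_comm] using dist_le_dist_add_one_of_adj u h

theorem dist_eq_two_of_adj_adj (hX : X.Connected) {v z w : V} (hvz : X.Adj v z) (hzw : X.Adj z w)
    (hne : v ≠ w) (hvw : ¬ X.Adj v w) : X.dist v w = 2 := by
  refine le_antisymm ?_ (hX.one_lt_dist_of_ne_of_not_adj hne hvw)
  have := dist_le_dist_add_one_of_adj v hzw.symm
  rwa [dist_eq_one_iff_adj.2 hvz] at this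

theorem exists_adj_adj_of_dist_eq_two (hX : X.Connected) {v w : V} (h : X.dist v w = 2) :
    ∃ p, X.Adj v p ∧ X.Adj p w := by
  have hne : v ≠ w := by
    rintro rfl
    simp at h
  obtain ⟨p, hwp, hp⟩ := exists_adj_dist_add_one hX hne
  exact ⟨p, dist_eq_one_iff_adj.1 (by omega), hwp.symm⟩

theorem not_adj_of_dist_add_two_le (u : V) {v w : V} (h : X.dist u v + 2 ≤ X.dist u w) :
    ¬ X.Adj v w := fun hvw => by
  have := dist_le_dist_add_one_of_adj u hvw.symm
  omega

theorem dist_add_one_eq_and_dist_eq_two (hX : X.Connected) {u y z r t : V} (hyr : X.Adj y r)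
    (hrt : X.Adj r t) (htz : X.Adj t z) (hy : X.dist u y + 2 = X.dist u t)
    (ht : X.dist u t + 1 = X.dist u z) : X.dist u r + 1 = X.dist u t ∧ X.dist r z = 2 := by
  have hle_y := dist_le_dist_add_one_of_adj u hyr.symm
  have hle_t := dist_le_dist_add_one_of_adj u hrt.symm
  refine ⟨by omega, dist_eq_two_of_adj_adj hX hrt htz ?_
    (not_adj_of_dist_add_two_le u (by omega))⟩
  rintro rfl
  omega

end Distance

namespace IsQuasiMedianGraph

variable {V : Type u} {X : SimpleGraph V}

theorem exists_triangle (hX : IsQuasiMedianGraph X) {u v w : V} (hvw : X.Adj v w)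
    (h : X.dist u v = X.dist u w) :
    ∃ x, X.Adj x v ∧ X.Adj x w ∧ X.dist u x + 1 = X.dist u v := by
  obtain ⟨⟨y₁, y₂, y₃⟩, ⟨k, ⟨⟨h₁₂, h₁₃, h₂₃⟩, k₁₂, k₁₃, k₂₃⟩, -⟩, -⟩ :=
    hX.existsUnique_quasiMedian u v w
  simp only at h₁₂ h₁₃ h₂₃ k₁₂ k₁₃ k₂₃
  rw [dist_eq_one_iff_adj.2 hvw] at h₂₃
  rw [SimpleGraph.dist_comm (u := y₂)] at h₁₂
  obtain rfl : v = y₂ := hX.connected.dist_eq_zero_iff.1 (by omega)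
  obtain rfl : y₃ = w := hX.connected.dist_eq_zero_iff.1 (by omega)
  rw [SimpleGraph.dist_self] at h₁₂ h₂₃
  exact ⟨y₁, dist_eq_one_iff_adj.1 (by omega), dist_eq_one_iff_adj.1 (by omega), by omega⟩

theorem exists_common_of_hexagon (hX : IsQuasiMedianGraph X) {f : Fin 6 → V}
    (hadj : ∀ i, X.Adj (f i) (f (i + 1))) (hdist : ∀ i, X.dist (f i) (f (i + 3)) = 3) :
    ∃ x, X.Adj x (f 1) ∧ X.Adj x (f 3) ∧ X.Adj x (f 5) := by
  have hiso := dist_map_cycleGraph_six hX.connected hadj hdist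
  have hinj : f.Injective := fun i j h => cycleGraph_connected.dist_eq_zero_iff.1 <| by
    rw [← hiso, h, SimpleGraph.dist_self]
  obtain ⟨e⟩ := hX.hexagon_hull f hiso
  let g (i : Fin 6) : convHull X (Set.range f) := ⟨f i, fun _ hT => hT.1 ⟨i, rfl⟩⟩
  have hg (i j : Fin 6) : cube3.Adj (e (g i)) (e (g j)) ↔ X.Adj (f i) (f j) := e.map_adj_iff
  have hfar : ¬ X.Adj (f 0) (f 3) := fun h => by
    have := hdist 0
    rw [zero_add, dist_eq_one_iff_adj.2 h] at this
    omega
  have hne : e (g 1) ≠ e (g 5) := fun h =>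
    absurd (hinj (congrArg Subtype.val (e.injective h))) (by decide)
  obtain ⟨x, hx₁, hx₅, hx₃⟩ := cube3_exists_common ((hg 0 1).2 (hadj 0)) ((hg 0 5).2 (hadj 5).symm)
    hne ((hg 1 2).2 (hadj 1)) ((hg 2 3).2 (hadj 2)) (mt (hg 0 3).1 hfar)
  obtain ⟨x, rfl⟩ := e.surjective x
  rw [e.map_adj_iff] at hx₁ hx₃ hx₅
  exact ⟨x, hx₁.symm, hx₃, hx₅.symm⟩

theorem exists_median_of_dist_eq_two (hX : IsQuasiMedianGraph X) {u v w : V}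
    (h : X.dist u v = X.dist u w) (hvw : X.dist v w = 2) :
    (∃ x, X.Adj x v ∧ X.Adj x w ∧ X.dist u x + 1 = X.dist u v) ∨
      ∃ y, X.dist y v = 2 ∧ X.dist y w = 2 ∧ X.dist u y + 2 = X.dist u v := by
  obtain ⟨⟨y₁, y₂, y₃⟩, ⟨k, ⟨⟨h₁₂, h₁₃, h₂₃⟩, k₁₂, k₁₃, k₂₃⟩, -⟩, -⟩ :=
    hX.existsUnique_quasiMedian u v w
  simp only at h₁₂ h₁₃ h₂₃ k₁₂ k₁₃ k₂₃
  rw [SimpleGraph.dist_comm (u := y₂)] at h₁₂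
  obtain rfl | rfl : k = 0 ∨ k = 2 := by omega
  · obtain rfl : y₁ = y₂ := hX.connected.dist_eq_zero_iff.1 k₁₂
    obtain rfl : y₁ = y₃ := hX.connected.dist_eq_zero_iff.1 k₁₃
    rw [SimpleGraph.dist_self] at h₁₂ h₁₃ h₂₃
    rw [SimpleGraph.dist_comm (u := v) (v := y₁)] at h₁₂ h₂₃
    exact .inl ⟨y₁, dist_eq_one_iff_adj.1 (by omega), dist_eq_one_iff_adj.1 (by omega), by omega⟩
  · obtain rfl : v = y₂ := hX.connected.dist_eq_zero_iff.1 (by omega)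
    obtain rfl : y₃ = w := hX.connected.dist_eq_zero_iff.1 (by omega)
    rw [SimpleGraph.dist_self] at h₁₂
    exact .inr ⟨y₁, k₁₂, k₁₃, by omega⟩

theorem dist_eq_three_of_not_adj (hX : IsQuasiMedianGraph X) {u z v q : V} (hzv : X.Adj z v)
    (hv : X.dist u v + 1 = X.dist u z) (hq : X.dist u q + 2 = X.dist u z) (hzq : X.dist q z = 2)
    (hvq : ¬ X.Adj v q) : X.dist v q = 3 := by
  have hle := dist_le_dist_add_one_of_adj q hzv.symm
  have hne : v ≠ q := by
    rintro rfl
    omega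
  have hlt := hX.connected.one_lt_dist_of_ne_of_not_adj hne hvq
  rw [SimpleGraph.dist_comm] at hlt ⊢
  suffices h : X.dist q v ≠ 2 by omega
  intro h
  obtain ⟨r, hrv, hrz, hr⟩ := hX.exists_triangle hzv.symm (h.trans hzq.symm)
  have hqr : X.Adj q r := dist_eq_one_iff_adj.1 (by omega)
  have hle_q := dist_le_dist_add_one_of_adj u hqr.symm
  have hle_z := dist_le_dist_add_one_of_adj u hrz.symm
  obtain ⟨t, htr, htv, ht⟩ := hX.exists_triangle hrv (show X.dist u r = X.dist u v by omega)
  have htz : t ≠ z := by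
    rintro rfl
    omega
  exact not_adj_of_dist_add_two_le u (show X.dist u t + 2 ≤ X.dist u z by omega)
    (hX.no_K4_minus r v t z hrv htr.symm hrz htv.symm hzv.symm htz)

theorem exists_quadrangle (hX : IsQuasiMedianGraph X) {u z v w : V} (hzv : X.Adj z v)
    (hzw : X.Adj z w) (hne : v ≠ w) (hvw : ¬ X.Adj v w) (hv : X.dist u v + 1 = X.dist u z)
    (hw : X.dist u w + 1 = X.dist u z) :
    ∃ x, X.Adj x v ∧ X.Adj x w ∧ X.dist u x + 1 = X.dist u v := by
  have hdist_vw := dist_eq_two_of_adj_adj hX.connected hzv.symm hzw hne hvw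
  obtain hx | ⟨y, hyv, hyw, hy⟩ := hX.exists_median_of_dist_eq_two (u := u) (by omega) hdist_vw
  · exact hx
  obtain ⟨p, hyp, hpv⟩ := exists_adj_adj_of_dist_eq_two hX.connected hyv
  obtain ⟨q, hyq, hqw⟩ := exists_adj_adj_of_dist_eq_two hX.connected hyw
  obtain ⟨hp, hpz⟩ :=
    dist_add_one_eq_and_dist_eq_two hX.connected hyp hpv hzv.symm hy hv
  obtain ⟨hq, hqz⟩ :=
    dist_add_one_eq_and_dist_eq_two hX.connected hyq hqw hzw.symm (by omega) hw
  by_cases hpw : X.Adj w p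
  · exact ⟨p, hpv, hpw.symm, hp⟩
  by_cases hvq : X.Adj v q
  · exact ⟨q, hvq.symm, hqw, by omega⟩
  have hvq_dist := hX.dist_eq_three_of_not_adj hzv hv (by omega) hqz hvq
  have hwp_dist := hX.dist_eq_three_of_not_adj hzw hw (by omega) hpz hpw
  have hzy_dist : X.dist z y = 3 := by
    have hle := dist_le_dist_add_one_of_adj y hzv
    have htri := hX.connected.dist_triangle (u := u) (v := y) (w := z)
    rw [SimpleGraph.dist_comm]
    omega
  have comm {a b : V} (h : X.dist a b = 3) : X.dist b a = 3 := SimpleGraph.dist_comm.trans h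
  obtain ⟨x, hxv, hxy, hxw⟩ : ∃ x, X.Adj x v ∧ X.Adj x y ∧ X.Adj x w :=
    hX.exists_common_of_hexagon (f := ![z, v, p, y, q, w])
      (fun i => by
        fin_cases i
        exacts [hzv, hpv.symm, hyp.symm, hyq, hqw, hzw.symm])
      (fun i => by
        fin_cases i
        exacts [hzy_dist, hvq_dist, comm hwp_dist, comm hzy_dist, comm hvq_dist, hwp_dist])
  have hle_y := dist_le_dist_add_one_of_adj u hxy
  have hle_v := dist_le_dist_add_one_of_adj u hxv.symm
  exact ⟨x, hxv, hxw, by omega⟩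

theorem isQuasiMedianOf_of_adj (hX : X.Connected) {a x y z : V} (hax : X.Adj a x)
    (hay : X.Adj a y) (haz : X.Adj a z) (hxy : x ≠ y) (hxz : x ≠ z) (hyz : y ≠ z)
    (nxy : ¬ X.Adj x y) (nxz : ¬ X.Adj x z) (nyz : ¬ X.Adj y z) :
    IsQuasiMedianOf X x y z a a a := by
  have d (v w : V) (h : X.Adj v w) : X.dist v w = 1 := dist_eq_one_iff_adj.2 h
  refine ⟨0, ⟨⟨?_, ?_, ?_⟩, by simp⟩, by simp⟩
  · rw [dist_eq_two_of_adj_adj hX hax.symm hay hxy nxy, d x a hax.symm, d a y hay,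
      SimpleGraph.dist_self]
  · rw [dist_eq_two_of_adj_adj hX hax.symm haz hxz nxz, d x a hax.symm, d a z haz,
      SimpleGraph.dist_self]
  · rw [dist_eq_two_of_adj_adj hX hay.symm haz hyz nyz, d y a hay.symm, d a z haz,
      SimpleGraph.dist_self]

theorem eq_of_common_neighbors (hX : IsQuasiMedianGraph X) {a b x y z : V} (hax : X.Adj a x)
    (hay : X.Adj a y) (haz : X.Adj a z) (hbx : X.Adj b x) (hby : X.Adj b y) (hbz : X.Adj b z)
    (hxy : x ≠ y) (hxz : x ≠ z) (hyz : y ≠ z) (nxy : ¬ X.Adj x y) (nxz : ¬ X.Adj x z)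
    (nyz : ¬ X.Adj y z) : a = b :=
  congrArg Prod.fst <| (hX.existsUnique_quasiMedian x y z).unique (y₁ := (a, a, a))
    (y₂ := (b, b, b)) (isQuasiMedianOf_of_adj hX.connected hax hay haz hxy hxz hyz nxy nxz nyz)
    (isQuasiMedianOf_of_adj hX.connected hbx hby hbz hxy hxz hyz nxy nxz nyz)

end IsQuasiMedianGraph

/-! ### Parallel edges and sides of hyperplanes -/

section Hyperplanes

variable {V : Type u} {X : SimpleGraph V} {H K L : Hyperplane X}

theorem IsInducedSquare.flip {a b c d : V} (h : IsInducedSquare X a b c d) :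
    IsInducedSquare X d c b a := by
  obtain ⟨hab, hbc, hcd, hda, hac, hbd, nac, nbd⟩ := h
  exact ⟨hcd.symm, hbc.symm, hab.symm, hda.symm, hbd.symm, hac.symm, fun h => nbd h.symm,
    fun h => nac h.symm⟩

theorem IsInducedSquare.mirror {a b c d : V} (h : IsInducedSquare X a b c d) :
    IsInducedSquare X b a d c :=
  h.reflect.flip.reflect

/-- The vertices `a` and `b` span an edge dual to the hyperplane `H`. -/
def IsDual (X : SimpleGraph V) (H : Hyperplane X) (a b : V) : Prop :=
  ∃ h : X.Adj a b, dualHyperplane X ⟨s(a, b), h⟩ = H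

namespace IsDual

variable {a b c d : V}

theorem adj (h : IsDual X H a b) : X.Adj a b := h.1

theorem of_edge {e : X.edgeSet} (he : (e : Sym2 V) = s(a, b)) (h : dualHyperplane X e = H) :
    IsDual X H a b := by
  obtain ⟨e, he'⟩ := e
  subst he
  exact ⟨he', h⟩

theorem symm (h : IsDual X H a b) : IsDual X H b a := by
  obtain ⟨hab, hH⟩ := h
  exact of_edge (e := ⟨s(a, b), hab⟩) Sym2.eq_swap hH

theorem eq (h : IsDual X H a b) (h' : IsDual X K a b) : H = K := by
  obtain ⟨_, rfl⟩ := h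
  exact h'.2

theorem triangle (h : IsDual X H a b) (hac : X.Adj a c) (hbc : X.Adj b c) : IsDual X H a c := by
  obtain ⟨hab, rfl⟩ := h
  exact ⟨hac, Quotient.sound (.symm _ _ (.rel _ _ (.inl ⟨a, b, c, hab, hbc, hac, rfl, rfl⟩)))⟩

theorem square (h : IsDual X H a b) (hs : IsInducedSquare X a b c d) : IsDual X H d c := by
  obtain ⟨hab, rfl⟩ := h
  exact ⟨hs.flip.1, Quotient.sound (.symm _ _ (.rel _ _ (.inr ⟨a, b, c, d, hs, rfl, rfl⟩)))⟩

theorem induction {P : V → V → Prop} (swap : ∀ a b, P a b → P b a)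
    (triangle : ∀ a b c, X.Adj a b → X.Adj a c → X.Adj b c → P a b → P a c)
    (square : ∀ a b c d, IsInducedSquare X a b c d → P a b → P d c)
    (hab : IsDual X H a b) (hcd : IsDual X H c d) (h : P a b) : P c d := by
  let Q (e : X.edgeSet) : Prop := Sym2.lift ⟨P, fun a b => propext ⟨swap a b, swap b a⟩⟩ e
  have hQ : parallelSetoid X ≤ Setoid.ker Q := Setoid.eqvGen_le fun e f hef => propext <| by
    rcases hef with ⟨a, b, c, hab, hbc, hac, he, hf⟩ | ⟨a, b, c, d, hs, he, hf⟩
    · simp only [Q, he, hf]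
      exact ⟨triangle a b c hab hac hbc, triangle a c b hac hab hbc.symm⟩
    · simp only [Q, he, hf]
      exact ⟨square a b c d hs, square d c b a hs.flip⟩
  obtain ⟨hab, rfl⟩ := hab
  obtain ⟨hcd, hH⟩ := hcd
  exact (hQ (Quotient.exact hH)).mpr h

end IsDual

theorem mem_carrier_iff {v : V} : v ∈ carrier X H ↔ ∃ w, IsDual X H v w := by
  constructor
  · rintro ⟨e, he, w, hw⟩
    exact ⟨w, IsDual.of_edge hw he⟩
  · rintro ⟨w, h, rfl⟩
    exact ⟨_, rfl, Sym2.mem_mk_left v w⟩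

theorem IsDual.left_mem_carrier {a b : V} (h : IsDual X H a b) : a ∈ carrier X H :=
  mem_carrier_iff.2 ⟨b, h⟩

theorem IsDual.right_mem_carrier {a b : V} (h : IsDual X H a b) : b ∈ carrier X H :=
  h.symm.left_mem_carrier

theorem exists_isDual (H : Hyperplane X) : ∃ a b, IsDual X H a b := by
  obtain ⟨⟨e, he⟩, rfl⟩ := Quotient.exists_rep H
  induction e with | _ a b => exact ⟨a, b, he, rfl⟩

theorem crosses_iff : Crosses X H K ↔
    ∃ a b c d, IsInducedSquare X a b c d ∧ IsDual X H a b ∧ IsDual X K a d := by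
  constructor
  · rintro ⟨a, b, c, d, e, f, hs, he, hf, hH, hK⟩
    exact ⟨a, b, c, d, hs, .of_edge he hH, .of_edge hf hK⟩
  · rintro ⟨a, b, c, d, hs, ⟨hab, hH⟩, ⟨had, hK⟩⟩
    exact ⟨a, b, c, d, _, _, hs, rfl, rfl, hH, hK⟩

theorem Crosses.carrier_inter (h : Crosses X H K) : (carrier X H ∩ carrier X K).Nonempty := by
  obtain ⟨a, b, c, d, -, hH, hK⟩ := crosses_iff.1 h
  exact ⟨a, hH.left_mem_carrier, hK.left_mem_carrier⟩

/-- `H` and `K` are distinct hyperplanes that do not cross. -/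
def Noncrossing (X : SimpleGraph V) (H K : Hyperplane X) : Prop := H ≠ K ∧ ¬ Crosses X H K

theorem Noncrossing.symm (h : Noncrossing X H K) : Noncrossing X K H :=
  ⟨h.1.symm, fun hc => h.2 hc.symm⟩

/-- `u` and `v` lie in the same sector delimited by `H`: each edge dual to `H` has the same
endpoint closest to `u` and to `v`, if any. -/
def SameSide (X : SimpleGraph V) (H : Hyperplane X) (u v : V) : Prop :=
  ∀ x y, IsDual X H x y → (X.dist u x < X.dist u y ↔ X.dist v x < X.dist v y)

namespace SameSide

variable {u v w a b : V}

theorem refl (u : V) : SameSide X H u u := fun _ _ _ => Iff.rfl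

theorem symm (h : SameSide X H u v) : SameSide X H v u := fun x y hxy => (h x y hxy).symm

theorem trans (h : SameSide X H u v) (h' : SameSide X H v w) : SameSide X H u w :=
  fun x y hxy => (h x y hxy).trans (h' x y hxy)

theorem not_of_dist (hab : IsDual X H a b) (hu : X.dist u a < X.dist u b)
    (hv : X.dist v b < X.dist v a) : ¬ SameSide X H u v :=
  fun h => lt_asymm hv ((h a b hab).1 hu)

end SameSide

namespace IsQuasiMedianGraph

theorem dist_lt_of_triangle (hX : IsQuasiMedianGraph X) {u a b c : V} (hab : X.Adj a b)
    (hac : X.Adj a c) (hbc : X.Adj b c) (h : X.dist u a < X.dist u b) :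
    X.dist u a < X.dist u c := by
  by_contra hc
  have hb := dist_le_dist_add_one_of_adj u hab.symm
  have hbc' := dist_le_dist_add_one_of_adj u hbc
  obtain ⟨e, hea, hec, he⟩ := hX.exists_triangle (u := u) hac (by omega)
  have hbe : b ≠ e := by
    rintro rfl
    omega
  exact not_adj_of_dist_add_two_le u (by omega)
    (hX.no_K4_minus a c b e hac hab hea.symm hbc.symm hec.symm hbe).symm

theorem isDual_of_dist_lt_of_dist_lt (hX : IsQuasiMedianGraph X) {u v x y : V} (huv : X.Adj u v)
    (hxy : IsDual X H x y) (hu : X.dist u x < X.dist u y) (hv : X.dist v y < X.dist v x) :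
    IsDual X H u v := by
  induction hn : X.dist u x generalizing x y with
  | zero =>
    obtain rfl := hX.connected.dist_eq_zero_iff.1 hn
    rw [dist_eq_one_iff_adj.2 huv.symm] at hv
    obtain rfl := hX.connected.dist_eq_zero_iff.1 (Nat.lt_one_iff.1 hv)
    exact hxy
  | succ n ih =>
    have hux : u ≠ x := by
      rintro rfl
      simp at hn
    obtain ⟨x', hxx', hx'⟩ := exists_adj_dist_add_one hX.connected hux
    have hy := dist_le_dist_add_one_of_adj u hxy.adj.symm
    have hvx := dist_le_dist_add_one_of_adj_left huv.symm x
    have huy := dist_le_dist_add_one_of_adj_left huv y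
    have hvx' := dist_le_dist_add_one_of_adj_left huv.symm x'
    have hvxx' := dist_le_dist_add_one_of_adj v hxx'
    have nx'y : ¬ X.Adj x' y := not_adj_of_dist_add_two_le u (by omega)
    have hx'y : x' ≠ y := by
      rintro rfl
      omega
    obtain ⟨y', hy'x', hy'y, hy'⟩ := hX.exists_quadrangle (u := v) hxx' hxy.adj hx'y nx'y
      (by omega) (by omega)
    have hxy' : x ≠ y' := by
      rintro rfl
      omega
    have hs : IsInducedSquare X x y y' x' :=
      ⟨hxy.adj, hy'y.symm, hy'x', hxx'.symm, hxy', hx'y.symm,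
        fun h => not_adj_of_dist_add_two_le v (by omega) h.symm, fun h => nx'y h.symm⟩
    have huyy' := dist_le_dist_add_one_of_adj u hy'y.symm
    exact ih (hxy.square hs) (by omega) (by omega) (by omega)

theorem isDual_of_dist_lt (hX : IsQuasiMedianGraph X) {u v x y : V} (huv : X.Adj u v)
    (hxy : IsDual X H x y) (hu : X.dist u x < X.dist u y) (hv : X.dist v y ≤ X.dist v x) :
    IsDual X H u v := by
  obtain hv | hv := hv.lt_or_eq
  · exact hX.isDual_of_dist_lt_of_dist_lt huv hxy hu hv
  · obtain ⟨z, hzx, hzy, hz⟩ := hX.exists_triangle (u := v) hxy.adj hv.symm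
    exact hX.isDual_of_dist_lt_of_dist_lt huv (hxy.triangle hzx.symm hzy.symm)
      (hX.dist_lt_of_triangle hxy.adj hzx.symm hzy.symm hu) (by omega)

theorem sameSide_of_adj (hX : IsQuasiMedianGraph X) {u v : V} (huv : X.Adj u v)
    (h : ¬ IsDual X H u v) : SameSide X H u v := fun _ _ hxy =>
  ⟨fun hu => lt_of_not_ge fun hv => h (hX.isDual_of_dist_lt huv hxy hu hv),
    fun hv => lt_of_not_ge fun hu => h (hX.isDual_of_dist_lt huv.symm hxy hv hu).symm⟩

theorem sameSide_of_isDual (hX : IsQuasiMedianGraph X) (hne : K ≠ H) {u v : V}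
    (h : IsDual X K u v) : SameSide X H u v :=
  hX.sameSide_of_adj h.adj fun h' => hne (h.eq h')

theorem sameSide_of_mem_carrier (hX : IsQuasiMedianGraph X) (hKH : Noncrossing X K H) {u v : V}
    (hu : u ∈ carrier X K) (hv : v ∈ carrier X K) : SameSide X H u v := by
  obtain ⟨u', hu'⟩ := mem_carrier_iff.1 hu
  obtain ⟨v', hv'⟩ := mem_carrier_iff.1 hv
  refine (hu'.induction (P := fun x y => IsDual X K x y ∧ SameSide X H u x ∧ SameSide X H u y)
    (fun x y h => ⟨h.1.symm, h.2.2, h.2.1⟩) ?_ ?_ hv'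
    ⟨hu', .refl u, hX.sameSide_of_isDual hKH.1 hu'⟩).2.1
  · rintro a b c - hac hbc ⟨hab, ha, -⟩
    have hac' := hab.triangle hac hbc
    exact ⟨hac', ha, ha.trans (hX.sameSide_of_isDual hKH.1 hac')⟩
  · rintro a b c d hs ⟨hab, ha, -⟩
    have had : SameSide X H a d := hX.sameSide_of_adj hs.reflect.1 fun had =>
      hKH.2 (crosses_iff.2 ⟨a, b, c, d, hs, hab, had⟩)
    have hdc := hab.square hs
    exact ⟨hdc, ha.trans had, (ha.trans had).trans (hX.sameSide_of_isDual hKH.1 hdc)⟩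

/-! ### Crossing hyperplanes -/

theorem isInducedSquare_of_prism (hX : IsQuasiMedianGraph X) {a b c d z m : V}
    (hs : IsInducedSquare X a b c d) (hza : X.Adj z a) (hzb : X.Adj z b) (hmc : X.Adj m c)
    (hmd : X.Adj m d) (hzm : X.Adj z m) : IsInducedSquare X a z m d := by
  obtain ⟨hab, -, hcd, hda, hac, hbd, nac, nbd⟩ := hs
  refine ⟨hza.symm, hzm, hmd, hda, ?_, ?_, fun ham => ?_, fun hzd => ?_⟩
  · rintro rfl
    exact nac hmc
  · rintro rfl
    exact nbd hzb.symm
  · exact nac (hX.no_K4_minus m d a c hmd ham.symm hmc hda hcd.symm hac)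
  · exact nbd (hX.no_K4_minus a z b d hza.symm hab hda.symm hzb hzd hbd)

theorem exists_prism (hX : IsQuasiMedianGraph X) {a b c d z : V} (hs : IsInducedSquare X a b c d)
    (hza : X.Adj z a) (hzb : X.Adj z b) :
    ∃ m, X.Adj m c ∧ X.Adj m d ∧ IsInducedSquare X a z m d ∧ IsInducedSquare X b z m c := by
  have ⟨hab, hbc, hcd, hda, hac, hbd, nac, nbd⟩ := hs
  have hzc : X.dist z c = 2 := dist_eq_two_of_adj_adj hX.connected hzb hbc
    (by rintro rfl; exact nac hza.symm)
    fun hzc => nac (hX.no_K4_minus b z a c hzb.symm hab.symm hbc hza hzc hac)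
  have hzd : X.dist z d = 2 := dist_eq_two_of_adj_adj hX.connected hza hda.symm
    (by rintro rfl; exact nbd hzb.symm)
    fun hzd => nbd (hX.no_K4_minus a z b d hza.symm hab hda.symm hzb hzd hbd)
  obtain ⟨m, hmc, hmd, hm⟩ := hX.exists_triangle (u := z) hcd (by omega)
  have hzm : X.Adj z m := dist_eq_one_iff_adj.1 (by omega)
  exact ⟨m, hmc, hmd, hX.isInducedSquare_of_prism hs hza hzb hmc hmd hzm,
    hX.isInducedSquare_of_prism hs.mirror hzb hza hmd hmc hzm⟩

theorem dist_lt_of_square_of_dist_lt (hX : IsQuasiMedianGraph X) {a b c d u : V}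
    (hs : IsInducedSquare X a b c d) (ha : X.dist u a < X.dist u b)
    (hc : X.dist u c < X.dist u b) : X.dist u d < X.dist u c := by
  obtain ⟨hab, hbc, hcd, hda, hac, hbd, nac, nbd⟩ := hs
  by_contra hd
  have hba := dist_le_dist_add_one_of_adj u hab.symm
  have hbc' := dist_le_dist_add_one_of_adj u hbc
  obtain ⟨f, hfa, hfc, hf⟩ := hX.exists_quadrangle (u := u) hab.symm hbc hac nac (by omega)
    (by omega)
  have hbf : b ≠ f := by
    rintro rfl
    omega
  have hdf : d ≠ f := by
    rintro rfl
    omega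
  have nbf : ¬ X.Adj f b := not_adj_of_dist_add_two_le u (by omega)
  have ndf : ¬ X.Adj d f := fun hdf =>
    nac (hX.no_K4_minus d f a c hdf hda hcd.symm hfa hfc hac)
  exact hac (hX.eq_of_common_neighbors hab hda.symm hfa.symm hbc.symm hcd hfc.symm hbd hbf hdf
    nbd (fun h => nbf h.symm) ndf)

theorem dist_lt_of_square (hX : IsQuasiMedianGraph X) {a b c d u : V}
    (hs : IsInducedSquare X a b c d) (h : X.dist u a < X.dist u b) :
    X.dist u d < X.dist u c := by
  by_cases hc : X.dist u c < X.dist u b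
  · exact hX.dist_lt_of_square_of_dist_lt hs h hc
  by_contra hd
  have hb := dist_le_dist_add_one_of_adj u hs.1.symm
  have hda := dist_le_dist_add_one_of_adj u hs.reflect.1.symm
  obtain ⟨e, hec, hed, he⟩ := hX.exists_triangle (u := u) hs.2.2.1 (by omega)
  obtain ⟨m, hmb, hma, hsa, -⟩ := hX.exists_prism hs.flip hed hec
  have hm := hX.dist_lt_of_triangle hs.1 hma.symm hmb.symm h
  have := hX.dist_lt_of_square_of_dist_lt hsa.flip hm (by omega)
  omega

end IsQuasiMedianGraph

/-- The vertices of the maximal clique that contains the edge `ab`, when `X` has no induced `K₄`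
minus an edge. -/
def edgeClique (X : SimpleGraph V) (a b : V) : Set V := {z | z = a ∨ z = b ∨ X.Adj z a ∧ X.Adj z b}

theorem edgeClique_comm (a b : V) : edgeClique X a b = edgeClique X b a := by
  ext z
  simp only [edgeClique, Set.mem_ofPred_eq]
  tauto

theorem left_mem_edgeClique (a b : V) : a ∈ edgeClique X a b := .inl rfl

theorem right_mem_edgeClique (a b : V) : b ∈ edgeClique X a b := .inr (.inl rfl)

theorem IsDual.of_mem_edgeClique {a b z : V} (h : IsDual X H a b) (hz : z ∈ edgeClique X a b)
    (hza : z ≠ a) : IsDual X H a z := by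
  obtain rfl | rfl | ⟨hz, hzb⟩ := hz
  · exact absurd rfl hza
  · exact h
  · exact h.triangle hz.symm hzb.symm

theorem mem_edgeClique_swap {a b z : V} (hab : X.Adj a b) (hz : z ∈ edgeClique X a b)
    (hza : z ≠ a) : b ∈ edgeClique X a z := by
  obtain rfl | rfl | ⟨-, hzb⟩ := hz
  · exact absurd rfl hza
  · exact right_mem_edgeClique a z
  · exact .inr (.inr ⟨hab.symm, hzb.symm⟩)

namespace IsQuasiMedianGraph

theorem adj_of_mem_edgeClique (hX : IsQuasiMedianGraph X) {a b z w : V} (hab : X.Adj a b)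
    (hz : z ∈ edgeClique X a b) (hw : w ∈ edgeClique X a b) (hzw : z ≠ w) : X.Adj z w := by
  obtain rfl | rfl | ⟨hza, hzb⟩ := hz <;> obtain rfl | rfl | ⟨hwa, hwb⟩ := hw
  · exact absurd rfl hzw
  · exact hab
  · exact hwa.symm
  · exact hab.symm
  · exact absurd rfl hzw
  · exact hwb.symm
  · exact hza
  · exact hzb
  · exact hX.no_K4_minus a b z w hab hza.symm hwa.symm hzb.symm hwb.symm hzw

theorem mem_edgeClique_of_triangle (hX : IsQuasiMedianGraph X) {a b c z : V} (hab : X.Adj a b)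
    (hac : X.Adj a c) (hbc : X.Adj b c) (hz : z ∈ edgeClique X a b) : z ∈ edgeClique X a c := by
  obtain rfl | rfl | ⟨hza, hzb⟩ := hz
  · exact left_mem_edgeClique z c
  · exact .inr (.inr ⟨hab.symm, hbc⟩)
  · by_cases hzc : z = c
    · exact .inr (.inl hzc)
    · exact .inr (.inr ⟨hza, hX.no_K4_minus a b z c hab hza.symm hac hzb.symm hbc hzc⟩)

theorem exists_square_of_mem_edgeClique (hX : IsQuasiMedianGraph X) {a b c d z : V}
    (hs : IsInducedSquare X a b c d) (hz : z ∈ edgeClique X a b) (hza : z ≠ a) :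
    ∃ z' ∈ edgeClique X d c, IsInducedSquare X a z z' d := by
  obtain rfl | rfl | ⟨hza', hzb⟩ := hz
  · exact absurd rfl hza
  · exact ⟨c, right_mem_edgeClique d c, hs⟩
  · obtain ⟨m, hmc, hmd, hsm, -⟩ := hX.exists_prism hs hza' hzb
    exact ⟨m, .inr (.inr ⟨hmd, hmc⟩), hsm⟩

theorem exists_square_of_mem_edgeClique_of_mem (hX : IsQuasiMedianGraph X) {a b c d z w : V}
    (hs : IsInducedSquare X a b c d) (hz : z ∈ edgeClique X a b) (hw : w ∈ edgeClique X a b)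
    (hzw : z ≠ w) :
    ∃ z' ∈ edgeClique X d c, ∃ w' ∈ edgeClique X d c, IsInducedSquare X z w w' z' := by
  by_cases hza : z = a
  · subst hza
    obtain ⟨w', hw', hsw⟩ := hX.exists_square_of_mem_edgeClique hs hw hzw.symm
    exact ⟨d, left_mem_edgeClique d c, w', hw', hsw⟩
  obtain ⟨z', hz', hsz⟩ := hX.exists_square_of_mem_edgeClique hs hz hza
  by_cases hwa : w = a
  · subst hwa
    exact ⟨z', hz', d, left_mem_edgeClique d c, hsz.mirror⟩
  have left := left_mem_edgeClique (X := X) a b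
  obtain ⟨m, hmz', hmd, -, hsm⟩ := hX.exists_prism hsz
    (hX.adj_of_mem_edgeClique hs.1 hw left hwa) (hX.adj_of_mem_edgeClique hs.1 hw hz hzw.symm)
  refine ⟨z', hz', m, ?_, hsm⟩
  have hm : m ∈ edgeClique X d z' := .inr (.inr ⟨hmd, hmz'⟩)
  obtain rfl | rfl | ⟨hz'd, hz'c⟩ := hz'
  · exact absurd rfl hsz.2.2.1.ne
  · exact hm
  · exact hX.mem_edgeClique_of_triangle hz'd.symm hs.flip.1 hz'c hm

theorem exists_dist_lt_and_dist_lt (hX : IsQuasiMedianGraph X) {a b c d : V}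
    (hab : IsDual X H a b) (hcd : IsDual X H c d) : ∃ z ∈ edgeClique X a b,
      ∃ w ∈ edgeClique X a b, X.dist c z < X.dist c w ∧ X.dist d w < X.dist d z := by
  refine hcd.induction (P := fun x y => ∃ z ∈ edgeClique X x y, ∃ w ∈ edgeClique X x y,
    X.dist c z < X.dist c w ∧ X.dist d w < X.dist d z) (fun x y h => ?_) ?_ ?_ hab ?_
  · rwa [edgeClique_comm]
  · rintro x y y' hxy hxy' hyy' ⟨z, hz, w, hw, h⟩
    exact ⟨z, hX.mem_edgeClique_of_triangle hxy hxy' hyy' hz, w,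
      hX.mem_edgeClique_of_triangle hxy hxy' hyy' hw, h⟩
  · rintro x y y' x' hs ⟨z, hz, w, hw, hc, hd⟩
    have hzw : z ≠ w := by
      rintro rfl
      exact lt_irrefl _ hc
    obtain ⟨z', hz', w', hw', hs'⟩ := hX.exists_square_of_mem_edgeClique_of_mem hs hz hw hzw
    exact ⟨z', hz', w', hw', hX.dist_lt_of_square hs' hc,
      hX.dist_lt_of_square hs'.mirror hd⟩
  · refine ⟨c, left_mem_edgeClique c d, d, right_mem_edgeClique c d, ?_, ?_⟩
    · rw [SimpleGraph.dist_self, dist_eq_one_iff_adj.2 hcd.adj]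
      exact one_pos
    · rw [SimpleGraph.dist_self, dist_eq_one_iff_adj.2 hcd.adj.symm]
      exact one_pos

theorem exists_mem_edgeClique_dist_lt (hX : IsQuasiMedianGraph X) {a b c d : V}
    (hab : IsDual X H a b) (hcd : IsDual X H c d) :
    ∃ z ∈ edgeClique X a b, X.dist c z < X.dist c a ∨ X.dist d z < X.dist d a := by
  obtain ⟨z, hz, w, hw, hc, hd⟩ := hX.exists_dist_lt_and_dist_lt hab hcd
  by_cases hza : z = a
  · exact ⟨w, hw, .inr (hza ▸ hd)⟩
  by_cases hwa : w = a
  · exact ⟨z, hz, .inl (hwa ▸ hc)⟩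
  have adj {x y : V} := hX.adj_of_mem_edgeClique (z := x) (w := y) hab.adj
  have left := left_mem_edgeClique (X := X) a b
  have hzw : z ≠ w := by
    rintro rfl
    exact lt_irrefl _ hc
  exact ⟨z, hz, .inl (hX.dist_lt_of_triangle (adj hz hw hzw) (adj hz left hza)
    (adj hw left hwa) hc)⟩

theorem exists_dist_lt_of_crosses (hX : IsQuasiMedianGraph X) {a b c : V} (hne : H ≠ K)
    (hHK : Crosses X H K) (hab : IsDual X H a b) (hac : IsDual X K a c) :
    ∃ u, (∃ z ∈ edgeClique X a b, X.dist u z < X.dist u a) ∧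
      ∃ w ∈ edgeClique X a c, X.dist u w < X.dist u a := by
  have transfer {M : Hyperplane X} {e p q z : V} (hM : IsDual X M a e) (hpq : SameSide X M p q)
      (hz : z ∈ edgeClique X a e) (h : X.dist p z < X.dist p a) : X.dist q z < X.dist q a := by
    have hza : z ≠ a := by
      rintro rfl
      exact lt_irrefl _ h
    exact (hpq z a (hM.of_mem_edgeClique hz hza).symm).1 h
  obtain ⟨p, q, r, s, hs, hpq, hps⟩ := crosses_iff.1 hHK
  have hqr : IsDual X K q r := hps.square hs.reflect
  have hsr : IsDual X H s r := hpq.square hs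
  obtain ⟨z, hz, hzp | hzq⟩ := hX.exists_mem_edgeClique_dist_lt hab hpq <;>
    obtain ⟨w, hw, hwp | hws⟩ := hX.exists_mem_edgeClique_dist_lt hac hps
  · exact ⟨p, ⟨z, hz, hzp⟩, w, hw, hwp⟩
  · exact ⟨s, ⟨z, hz, transfer hab (hX.sameSide_of_isDual hne.symm hps) hz hzp⟩, w, hw, hws⟩
  · exact ⟨q, ⟨z, hz, hzq⟩, w, hw, transfer hac (hX.sameSide_of_isDual hne hpq) hw hwp⟩
  · exact ⟨r, ⟨z, hz, transfer hab (hX.sameSide_of_isDual hne.symm hqr) hz hzq⟩, w, hw,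
      transfer hac (hX.sameSide_of_isDual hne hsr) hw hws⟩

theorem exists_square_of_crosses (hX : IsQuasiMedianGraph X) {a b c : V} (hne : H ≠ K)
    (hHK : Crosses X H K) (hab : IsDual X H a b) (hac : IsDual X K a c) :
    ∃ d, IsInducedSquare X a b d c := by
  obtain ⟨u, ⟨z, hz, hzu⟩, w, hw, hwu⟩ := hX.exists_dist_lt_of_crosses hne hHK hab hac
  have hza : z ≠ a := by
    rintro rfl
    exact lt_irrefl _ hzu
  have hwa : w ≠ a := by
    rintro rfl
    exact lt_irrefl _ hwu
  have haz := hab.of_mem_edgeClique hz hza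
  have haw := hac.of_mem_edgeClique hw hwa
  have hzw : z ≠ w := by
    rintro rfl
    exact hne (haz.eq haw)
  have nzw : ¬ X.Adj z w := fun h => hne ((haz.triangle haw.adj h).eq haw)
  have hduz := dist_le_dist_add_one_of_adj u haz.adj
  have hduw := dist_le_dist_add_one_of_adj u haw.adj
  obtain ⟨f, hfz, hfw, hf⟩ := hX.exists_quadrangle (u := u) haz.adj haw.adj hzw nzw (by omega)
    (by omega)
  have haf : a ≠ f := by
    rintro rfl
    omega
  have hs : IsInducedSquare X a z f w := ⟨haz.adj, hfz.symm, hfw, haw.adj.symm, haf, hzw,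
    fun h => not_adj_of_dist_add_two_le u (by omega) h.symm, nzw⟩
  obtain ⟨e, -, hs'⟩ := hX.exists_square_of_mem_edgeClique hs
    (mem_edgeClique_swap hab.adj hz hza) hab.adj.ne'
  obtain ⟨g, -, hs''⟩ := hX.exists_square_of_mem_edgeClique hs'.reflect
    (mem_edgeClique_swap hac.adj hw hwa) hac.adj.ne'
  exact ⟨g, hs''.reflect⟩

end IsQuasiMedianGraph

/-! ### Hyperplanes between two carriers -/

/-- The hyperplane `H` separates `K` from `L`: it neither equals nor crosses either of them, and
their carriers lie on different sides of it. -/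
def Separates (X : SimpleGraph V) (H K L : Hyperplane X) : Prop :=
  Noncrossing X H K ∧ Noncrossing X H L ∧
    ∀ u ∈ carrier X K, ∀ v ∈ carrier X L, ¬ SameSide X H u v

theorem carrier_inter_of_not_noncrossing (h : ¬ Noncrossing X H K) :
    (carrier X H ∩ carrier X K).Nonempty := by
  by_cases hHK : H = K
  · obtain ⟨a, b, hab⟩ := exists_isDual H
    exact ⟨a, hab.left_mem_carrier, hHK ▸ hab.left_mem_carrier⟩
  · exact (not_not.1 fun hc => h ⟨hHK, hc⟩ : Crosses X H K).carrier_inter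

namespace IsQuasiMedianGraph

theorem noncrossing_of_mem_carrier (hX : IsQuasiMedianGraph X) {v w : V} (hvw : IsDual X H v w)
    (hv : v ∈ carrier X K) (hw : w ∉ carrier X K) : Noncrossing X H K := by
  have hne : H ≠ K := by
    rintro rfl
    exact hw hvw.right_mem_carrier
  refine ⟨hne, fun hc => hw ?_⟩
  obtain ⟨t, ht⟩ := mem_carrier_iff.1 hv
  obtain ⟨s, hs⟩ := hX.exists_square_of_crosses hne hc hvw ht
  exact (ht.square hs.reflect).left_mem_carrier

theorem crosses_of_dist_lt (hX : IsQuasiMedianGraph X) {p v v' : V} (hp : p ∈ carrier X K)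
    (hv : v ∈ carrier X H) (hHK : ¬ Noncrossing X H K) (hLK : Noncrossing X L K)
    (hvv' : IsDual X L v v') (hdist : X.dist p v' < X.dist p v) : L ≠ H ∧ Crosses X L H := by
  have hLH : L ≠ H := by
    rintro rfl
    exact hHK hLK
  refine ⟨hLH, by_contra fun hc => ?_⟩
  obtain ⟨q, hqH, hqK⟩ := carrier_inter_of_not_noncrossing hHK
  refine SameSide.not_of_dist hvv'.symm hdist ?_ ((hX.sameSide_of_mem_carrier hLK.symm hp hqK).trans
    (hX.sameSide_of_mem_carrier (Noncrossing.symm ⟨hLH, hc⟩) hqH hv))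
  rw [SimpleGraph.dist_self, dist_eq_one_iff_adj.2 hvv'.adj]
  exact one_pos

theorem noncrossing_of_dist (hX : IsQuasiMedianGraph X) {p v w : V} (hp : p ∈ carrier X K)
    (hvw : IsDual X H v w) (hfar : ∀ q ∈ carrier X K, X.dist p v < X.dist q w) :
    Noncrossing X H K := by
  induction hn : X.dist p v generalizing H v w with
  | zero =>
    obtain rfl := hX.connected.dist_eq_zero_iff.1 hn
    exact hX.noncrossing_of_mem_carrier hvw hp fun hw => by simpa using hfar w hw
  | succ n ih =>
    by_contra hHK
    have hpv : p ≠ v := by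
      rintro rfl
      simp at hn
    obtain ⟨v', hvv', hpv'⟩ := exists_adj_dist_add_one hX.connected hpv
    have hLv : IsDual X (dualHyperplane X ⟨s(v, v'), hvv'⟩) v v' := ⟨hvv', rfl⟩
    have hLK := ih hLv.symm (fun q hq => by
      have := hfar q hq
      have := dist_le_dist_add_one_of_adj q hvw.adj.symm
      omega) (by omega)
    obtain ⟨hLH, hcross⟩ :=
      hX.crosses_of_dist_lt hp hvw.left_mem_carrier hHK hLK hLv (by omega)
    obtain ⟨s, hs⟩ := hX.exists_square_of_crosses hLH hcross hLv hvw
    refine hHK (ih (hvw.square hs.reflect) (fun q hq => ?_) (by omega))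
    have := hfar q hq
    have := dist_le_dist_add_one_of_adj q hs.2.2.1.symm
    omega

theorem separates_of_dist (hX : IsQuasiMedianGraph X) {p q v w : V}
    (hp : p ∈ carrier X K) (hq : q ∈ carrier X L)
    (hmin : ∀ p' ∈ carrier X K, ∀ q' ∈ carrier X L, X.dist p q ≤ X.dist p' q')
    (hvw : IsDual X H v w) (hgeo : X.dist p v + 1 + X.dist w q = X.dist p q) :
    Separates X H K L := by
  have htri (a b c : V) : X.dist a c ≤ X.dist a b + X.dist b c := hX.connected.dist_triangle
  have hcomm (a b : V) : X.dist a b = X.dist b a := SimpleGraph.dist_comm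
  have hHK : Noncrossing X H K := hX.noncrossing_of_dist hp hvw fun p' hp' => by
    have := hmin p' hp' q hq
    have := htri p' w q
    omega
  have hHL : Noncrossing X H L := hX.noncrossing_of_dist hq hvw.symm fun q' hq' => by
    have := hmin p hp q' hq'
    have := htri p v q'
    have := hcomm q' v
    have := hcomm q w
    omega
  have hpq : ¬ SameSide X H p q := by
    have := htri p w q
    have := htri p v q
    have := hcomm q w
    have := hcomm q v
    exact SameSide.not_of_dist hvw (by omega) (by omega)
  exact ⟨hHK, hHL, fun a ha b hb hab => hpq <|
    ((hX.sameSide_of_mem_carrier hHK.symm hp ha).trans hab).trans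
      (hX.sameSide_of_mem_carrier hHL.symm hb hq)⟩

theorem crosses_of_separates (hX : IsQuasiMedianGraph X) {G : Hyperplane X}
    (h : Separates X H K L) (hK : Crosses X G K) (hL : Crosses X G L) : G ≠ H ∧ Crosses X G H := by
  obtain ⟨hHK, -, hside⟩ := h
  have hGH : G ≠ H := by
    rintro rfl
    exact hHK.2 hK
  refine ⟨hGH, by_contra fun hc => ?_⟩
  obtain ⟨p, hpG, hpK⟩ := hK.carrier_inter
  obtain ⟨q, hqG, hqL⟩ := hL.carrier_inter
  exact hside p hpK q hqL (hX.sameSide_of_mem_carrier ⟨hGH, hc⟩ hpG hqG)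

theorem mem_domain_of_separates (hX : IsQuasiMedianGraph X) {J : Set (Hyperplane X)}
    (hJ : J ∈ domains X) (hK : K ∈ J) (hL : L ∈ J) (h : Separates X H K L) : H ∈ J := by
  obtain ⟨-, rfl | ⟨s, -, rfl⟩⟩ := hJ
  · exact Set.mem_univ H
  · simp only [Set.mem_iInter] at hK hL ⊢
    exact fun G hG => hX.crosses_of_separates h (hK G hG).2 (hL G hG).2

theorem sameSide_of_mem_domain (hX : IsQuasiMedianGraph X) {J : Set (Hyperplane X)}
    (hJ : J ∈ domains X) (hH : H ∉ J) (hK : K ∈ J) (hL : L ∈ J) (hHK : Noncrossing X H K)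
    (hHL : Noncrossing X H L) {u v : V} (hu : u ∈ carrier X K) (hv : v ∈ carrier X L) :
    SameSide X H u v := by
  by_contra hside
  refine hH (hX.mem_domain_of_separates hJ hK hL ⟨hHK, hHL, fun u' hu' v' hv' h => hside ?_⟩)
  exact ((hX.sameSide_of_mem_carrier hHK.symm hu hu').trans h).trans
    (hX.sameSide_of_mem_carrier hHL.symm hv' hv)

end IsQuasiMedianGraph

/-! ### Contact between hyperplanes -/

theorem contactGraph_adj_iff :
    (contactGraph X).Adj H K ↔ H ≠ K ∧ (carrier X H ∩ carrier X K).Nonempty := by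
  refine and_congr_right fun _ => ⟨fun h => h.elim Crosses.carrier_inter And.left, fun h => ?_⟩
  by_cases hc : Crosses X H K
  · exact .inl hc
  · exact .inr ⟨h, hc⟩

theorem reachable_induce_contactGraph (hX : X.Connected) {S : Set (Hyperplane X)}
    (hK : K ∈ S) (hL : L ∈ S) {v q : V} (hv : v ∈ carrier X K) (hq : q ∈ carrier X L)
    (hS : ∀ H a b, IsDual X H a b → X.dist v a + 1 + X.dist b q = X.dist v q → H ∈ S) :
    ((contactGraph X).induce S).Reachable ⟨K, hK⟩ ⟨L, hL⟩ := by
  have step {M N : Hyperplane X} (hM : M ∈ S) (hN : N ∈ S) {x : V} (hxM : x ∈ carrier X M)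
      (hxN : x ∈ carrier X N) : ((contactGraph X).induce S).Reachable ⟨M, hM⟩ ⟨N, hN⟩ := by
    by_cases hMN : M = N
    · subst hMN
      exact .rfl
    · exact (show ((contactGraph X).induce S).Adj ⟨M, hM⟩ ⟨N, hN⟩ from
        contactGraph_adj_iff.2 ⟨hMN, x, hxM, hxN⟩).reachable
  induction hn : X.dist v q generalizing K v with
  | zero =>
    obtain rfl := hX.dist_eq_zero_iff.1 hn
    exact step hK hL hv hq
  | succ n ih =>
    have hqv : q ≠ v := by
      rintro rfl
      simp at hn
    obtain ⟨w, hvw, hw⟩ := exists_adj_dist_add_one hX hqv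
    rw [SimpleGraph.dist_comm, SimpleGraph.dist_comm (v := v)] at hw
    have hH : IsDual X (dualHyperplane X ⟨s(v, w), hvw⟩) v w := ⟨hvw, rfl⟩
    have hHS := hS _ v w hH (by rw [SimpleGraph.dist_self]; omega)
    refine (step hK hHS hv hH.left_mem_carrier).trans
      (ih hHS hH.right_mem_carrier (fun M a b hab hgeo => hS M a b hab ?_) (by omega))
    have hva := dist_le_dist_add_one_of_adj_left hvw a
    have hvaq := hX.dist_triangle (u := v) (v := a) (w := q)
    have haq := dist_le_dist_add_one_of_adj_left hab.adj q
    omega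

/-- The hyperplanes `K` and `L` together with all those that separate them. -/
def contactInterval (X : SimpleGraph V) (K L : Hyperplane X) : Set (Hyperplane X) :=
  {H | H = K ∨ H = L ∨ Separates X H K L}

theorem left_mem_contactInterval (K L : Hyperplane X) : K ∈ contactInterval X K L := .inl rfl

theorem right_mem_contactInterval (K L : Hyperplane X) : L ∈ contactInterval X K L :=
  .inr (.inl rfl)

namespace IsQuasiMedianGraph

theorem contactInterval_subset (hX : IsQuasiMedianGraph X) {J : Set (Hyperplane X)}
    (hJ : J ∈ domains X) (hK : K ∈ J) (hL : L ∈ J) : contactInterval X K L ⊆ J := by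
  rintro H (rfl | rfl | hH)
  exacts [hK, hL, hX.mem_domain_of_separates hJ hK hL hH]

theorem reachable_induce_contactInterval (hX : IsQuasiMedianGraph X) (K L : Hyperplane X) :
    ((contactGraph X).induce (contactInterval X K L)).Reachable
      ⟨K, left_mem_contactInterval K L⟩ ⟨L, right_mem_contactInterval K L⟩ := by
  obtain ⟨p₀, _, hp₀⟩ := exists_isDual K
  obtain ⟨q₀, _, hq₀⟩ := exists_isDual L
  obtain ⟨⟨p, q⟩, ⟨hp, hq⟩, hmin⟩ := exists_minimalFor_of_wellFoundedLT
    (fun x : V × V => x.1 ∈ carrier X K ∧ x.2 ∈ carrier X L) (fun x => X.dist x.1 x.2)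
    ⟨(p₀, q₀), hp₀.left_mem_carrier, hq₀.left_mem_carrier⟩
  refine reachable_induce_contactGraph hX.connected _ _ hp hq fun H a b hab hgeo =>
    .inr (.inr (hX.separates_of_dist hp hq (fun p' hp' q' hq' => ?_) hab hgeo))
  exact (le_total _ _).elim id fun h => hmin (j := (p', q')) ⟨hp', hq'⟩ h

end IsQuasiMedianGraph

/-! ### Bottlenecks in factored contact graphs -/

variable {J : Set (Hyperplane X)}

/-- The hyperplanes represented by a vertex of the factored contact graph: `H` itself for a
hyperplane `H`, and the elements of `F` for the projection vertex of `F`. -/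
def hyperplanesOf : Hyperplane X ⊕ ProjVertex X → Set (Hyperplane X) :=
  Sum.elim (fun H => {H}) (fun F => F.1)

/-- A vertex of the factored contact graph lies on the side of `u` of a hyperplane `H` if the
carriers of all the hyperplanes that it represents do, apart from `H` and the hyperplanes crossing
`H`, which lie on no particular side of `H`. -/
def OnSideOf (X : SimpleGraph V) (H : Hyperplane X) (u : V) (z : Hyperplane X ⊕ ProjVertex X) :
    Prop :=
  ∀ K ∈ hyperplanesOf z, Noncrossing X H K → ∀ v ∈ carrier X K, SameSide X H u v

theorem OnSideOf.of_adj (hX : IsQuasiMedianGraph X) {u : V} {y z : Hyperplane X ⊕ ProjVertex X}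
    (hyz : (factoredContactGraph X).Adj y z)
    (hy : ¬ (y = .inl H ∨ (factoredContactGraph X).Adj y (.inl H)))
    (hz : ¬ (factoredContactGraph X).Adj z (.inl H)) (h : OnSideOf X H u y) :
    OnSideOf X H u z := by
  have noncrossing (K : Hyperplane X) (hK : ¬ ((.inl K : Hyperplane X ⊕ ProjVertex X) = .inl H ∨
      (factoredContactGraph X).Adj (.inl K) (.inl H))) : Noncrossing X H K := by
    have hne : K ≠ H := fun hKH => hK (.inl (congrArg Sum.inl hKH))
    exact ⟨hne.symm, fun hc => hK (.inr ⟨hne, .inl hc.symm⟩)⟩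
  match y, z with
  | .inl K, .inl L =>
    rintro _ rfl hHL v hv
    obtain ⟨-, w, hwK, hwL⟩ := contactGraph_adj_iff.1 hyz
    exact (h K rfl (noncrossing K hy) w hwK).trans (hX.sameSide_of_mem_carrier hHL.symm hwL hv)
  | .inl K, .inr F =>
    intro L hL hHL v hv
    obtain ⟨w, _, hw⟩ := exists_isDual K
    exact (h K rfl (noncrossing K hy) w hw.left_mem_carrier).trans
      (hX.sameSide_of_mem_domain F.2.1 hz hyz hL (noncrossing K hy) hHL hw.left_mem_carrier hv)
  | .inr F, .inl L =>
    rintro M rfl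
    exact h M hyz
  | .inr _, .inr _ => exact hyz.elim

/-- A hyperplane of `J` as a vertex of the factored contact graph of `J`. -/
def hyperplaneVertex (K : J) : domainVertices X J := ⟨.inl K, K.2⟩

theorem exists_mem_support_of_separates (hX : IsQuasiMedianGraph X) {H K L : J}
    (h : Separates X H K L)
    (W : (factoredContactGraphOf X J).Walk (hyperplaneVertex K) (hyperplaneVertex L)) :
    ∃ w ∈ W.support, (factoredContactGraphOf X J).dist (hyperplaneVertex H) w ≤ 1 := by
  obtain ⟨hHK, hHL, hKL⟩ := h
  obtain ⟨u, _, hu⟩ := exists_isDual K.1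
  obtain ⟨v, _, hv⟩ := exists_isDual L.1
  obtain ⟨d, hd, hfst, hsnd⟩ := W.exists_boundary_dart
    {z : domainVertices X J | OnSideOf X H u z.1}
    (by
      rintro _ rfl - w hw
      exact hX.sameSide_of_mem_carrier hHK.symm hu.left_mem_carrier hw)
    (fun hL => hKL u hu.left_mem_carrier v hv.left_mem_carrier
      (hL L rfl hHL v hv.left_mem_carrier))
  by_contra! hfar
  have hne : ∀ w ∈ W.support, ¬ (factoredContactGraph X).Adj w.1 (.inl H) := fun w hw hadj =>
    (hfar w hw).ne' (dist_eq_one_iff_adj.2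
      (show (factoredContactGraphOf X J).Adj (hyperplaneVertex H) w from hadj.symm))
  refine hsnd (OnSideOf.of_adj hX d.adj ?_ (hne _ (W.dart_snd_mem_support_of_mem_darts hd)) hfst)
  have hmem := W.dart_fst_mem_support_of_mem_darts hd
  rintro (heq | hadj)
  · have := hfar _ hmem
    rw [show d.fst = hyperplaneVertex H from Subtype.ext heq, SimpleGraph.dist_self] at this
    omega
  · exact hne _ hmem hadj

theorem exists_isTight_hyperplaneVertex (hX : IsQuasiMedianGraph X) (hJ : J ∈ domains X)
    (K L : J) :
    ∃ P : (factoredContactGraphOf X J).Walk (hyperplaneVertex K) (hyperplaneVertex L),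
      IsTight 1 P := by
  have hsub := hX.contactInterval_subset hJ K.2 L.2
  let φ : (contactGraph X).induce (contactInterval X K L) →g factoredContactGraphOf X J :=
    { toFun := fun H => hyperplaneVertex ⟨H, hsub H.2⟩
      map_rel' := id }
  obtain ⟨P⟩ := hX.reachable_induce_contactInterval K L
  refine ⟨P.map φ, fun z hz W => ?_⟩
  rw [Walk.support_map, List.mem_map] at hz
  obtain ⟨⟨H, hH⟩, -, rfl⟩ := hz
  have hself (z) (hz : z ∈ W.support) :
      ∃ w ∈ W.support, (factoredContactGraphOf X J).dist z w ≤ 1 :=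
    ⟨z, hz, by simp⟩
  obtain rfl | rfl | hsep := id hH
  · exact hself _ W.start_mem_support
  · exact hself _ W.end_mem_support
  · exact exists_mem_support_of_separates hX (H := ⟨H, hsub hH⟩) hsep W

theorem hasBottlenecks_factoredContactGraphOf (hX : IsQuasiMedianGraph X) (hJ : J ∈ domains X) :
    HasBottlenecks (factoredContactGraphOf X J) 3 := by
  refine hasBottlenecks_of_dense (S := Set.range hyperplaneVertex) ?_ ?_
  · rintro ⟨H | F, hF⟩
    · exact .inl ⟨⟨H, hF⟩, rfl⟩
    · obtain ⟨H, hH⟩ := F.2.1.1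
      exact .inr ⟨hyperplaneVertex ⟨H, hF.1 hH⟩, Set.mem_range_self _, hH⟩
  · rintro _ ⟨K, rfl⟩ _ ⟨L, rfl⟩
    exact exists_isTight_hyperplaneVertex hX hJ K L

theorem isQuasiTreeWith_factoredContactGraphOf (hX : IsQuasiMedianGraph X) (hJ : J ∈ domains X) :
    IsQuasiTreeWith 20 19 (factoredContactGraphOf X J) := by
  have : Nonempty (domainVertices X J) := hJ.1.elim fun K hK => ⟨hyperplaneVertex ⟨K, hK⟩⟩
  convert (hasBottlenecks_factoredContactGraphOf hX hJ).isQuasiTreeWith using 1 <;> norm_num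

/-- The factored contact graph of `X` is that of its largest domain. -/
def factoredContactGraphIso (X : SimpleGraph V) :
    factoredContactGraph X ≃g factoredContactGraphOf X Set.univ where
  toFun z := ⟨z, by
    rcases z with H | F
    · exact Set.mem_univ H
    · exact Set.ssubset_univ_iff.2 F.2.2⟩
  invFun z := z.1
  map_rel_iff' := Iff.rfl

end Hyperplanes

end QMGraph

theorem lemma4p15_general {V : Type u} {X : SimpleGraph V} (hX : QMGraph.IsQuasiMedianGraph X)
    (hne : Nonempty (QMGraph.Hyperplane X)) :
    QMGraph.IsQuasiTreeWith 20 19 (QMGraph.factoredContactGraph X) ∧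
      ∀ J ∈ QMGraph.domains X,
        QMGraph.IsQuasiTreeWith 20 19 (QMGraph.factoredContactGraphOf X J) :=
  ⟨.of_iso (QMGraph.factoredContactGraphIso X)
    (QMGraph.isQuasiTreeWith_factoredContactGraphOf hX
      ⟨Set.nonempty_iff_univ_nonempty.1 hne, .inl rfl⟩),
    fun _ hJ => QMGraph.isQuasiTreeWith_factoredContactGraphOf hX hJ⟩

/-- The factored contact graphs are uniform quasi-trees: there are absolute constants `L ≥ 1` and
`A ≥ 0` such that for every quasi-median graph `X` whose crossing graph admits a graph factor
system, the factored contact graph of `X` and the factored contact graph of each of its domains are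
`(L, A)`-quasi-isometric to trees. -/
theorem lemma4p15 :
    ∃ L A : ℝ, 1 ≤ L ∧ 0 ≤ A ∧
      ∀ (V : Type u) (X : SimpleGraph V), QMGraph.IsQuasiMedianGraph X →
        (∃ 𝔉 : Set (Set (QMGraph.Hyperplane X)),
          QMGraph.IsGraphFactorSystem (QMGraph.crossingGraph X) 𝔉) →
        QMGraph.IsQuasiTreeWith L A (QMGraph.factoredContactGraph X) ∧
        ∀ J ∈ QMGraph.domains X,
          QMGraph.IsQuasiTreeWith L A (QMGraph.factoredContactGraphOf X J) :=
  ⟨20, 19, by norm_num, by norm_num, fun _ _ hX ⟨_, h𝔉⟩ =>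
    lemma4p15_general hX (h𝔉.nonempty_of_mem _ h𝔉.univ_mem).to_type⟩
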